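/- Fix an integer $m>1$ and let $\Sigma=\{\alpha_1,\dots,\alpha_m\}\cup\{\beta_1,\dots,\beta_m\}$. The Dyck monoid $M$ is the monoid with zero generated by $\Sigma$ subject to $\alpha_j\beta_j\equiv 1$ and $\alpha_i\beta_j\equiv 0$ for $i\ne j$. The two-sided Dyck shift $X\subset\Sigma^{\mathbb Z}$ is the set of all $x$ such that $x_rx_{r+1}\cdots x_l\not\equiv 0 \pmod M$ for all integers $r\le l$. For $x\in X$ let $H_i(x)$ be the height: $H_0(x)=0$ and $H_{i+1}(x)-H_i(x)$ is $+1$ if $x_i\in\{\alpha_1,\dots,\alpha_m\}$ and $-1$ if $x_i\in\{\beta_1,\dots,\beta_m\}$. Put $$B_{-\infty}^{-\infty}=\Bigl\{x\in X:\ \liminf_{i\to+\infty}H_i(x)=\liminf_{i\to-\infty}H_i(x)=-\infty\Bigr\}.$$ The double-tail relation $\mathcal T_2=\mathcal T_2(X)$ consists of the pairs $(x,x')\in X\times X$ for which there is $n\ge 0$ with $x_k=x'_k$ for all $|k|>n$. A $\mathcal T_2$-holonomy is an injective Borel map $g:A\to g(A)$ with $A\subset X$ Borel and $(x,g(x))\in\mathcal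 T_2$ for every $x\in A$. A measure $\mu$ is $\mathcal T_2$-invariant if $\mu(A)=\mu(g(A))$ for every $\mathcal T_2$-holonomy $g:A\to g(A)$. The measure $\tilde\mu$ is defined as follows. For $z\in\{0,1\}^{\mathbb Z}$ let $\tilde H_0(z)=0$ and $\tilde H_{i+1}(z)-\tilde H_i(z)=+1$ if $z_i=1$ and $-1$ if $z_i=0$, and let $S$ be the set of $z$ with $\liminf_{i\to+\infty}\tilde H_i(z)=\liminf_{i\to-\infty}\tilde H_i(z)=-\infty$. Put $\gamma_k(z)=\sum_{i=0}^{k}z_i$ for $k\ge 0$, $\gamma_k(z)=-\sum_{i=k}^{-1}z_i$ for $k<0$, and $\varepsilon_n(z)=\max\{l<n:\tilde H_l(z)\le\tilde H_{n+1}(z)\}$. Define $F:S\times\{1,\dots,m\}^{\mathbb Z}\to\Sigma^{\mathbb Z}$ by $F(z,a)_n=\alpha_j$ if $z_n=1$ and $a_{\gamma_n(z)}=j$, and $F(z,a)_n=\beta_j$ if $z_n=0$ and $a_{\gamma_k(z)}=j$ with $k=\varepsilon_n(z)$. Let $\mu_1$ and $\mu_2$ be the symmetric (uniform) product measures on $\{0,1\}^{\mathbb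 Z}$ and $\{1,\dots,m\}^{\mathbb Z}$, and let $\tilde\mu=(\mu_1\times\mu_2)\circ F^{-1}$. **Proposition.** $\tilde\mu$ is the unique $\mathcal T_2$-invariant probability on $B_{-\infty}^{-\infty}$. That is, $\tilde\mu$ is a $\mathcal T_2$-invariant Borel probability measure with $\tilde\mu(B_{-\infty}^{-\infty})=1$, and every $\mathcal T_2$-invariant Borel probability measure $\nu$ with $\nu(B_{-\infty}^{-\infty})=1$ equals $\tilde\mu$. -/

import Mathlib

open Filter MeasureTheory ProbabilityTheory

noncomputable section

namespace DyckShift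

/-! ## Tail equivalence of two-sided sequences -/

/-- The double-tail (homoclinic) relation of a set `X` of two-sided sequences: both points lie in
`X` and they agree off a finite window of coordinates. -/
def doubleTail {S : Type*} (X : Set (ℤ → S)) : Set ((ℤ → S) × (ℤ → S)) :=
  {p | p.1 ∈ X ∧ p.2 ∈ X ∧ ∃ n : ℕ, ∀ k : ℤ, (n : ℤ) < |k| → p.1 k = p.2 k}

/-- `g`, restricted to the Borel set `A ⊆ X`, is a holonomy of the double-tail relation of `X`: it
is Borel and injective on `A` and moves every point of `A` within its double-tail class.
(The values of `g` off `A` are irrelevant.) -/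
structure IsHolonomy {S : Type*} [MeasurableSpace S] (X A : Set (ℤ → S))
    (g : (ℤ → S) → (ℤ → S)) : Prop where
  measurableSet : MeasurableSet A
  subset : A ⊆ X
  measurable : Measurable fun x : A => g x
  injOn : Set.InjOn g A
  mem_doubleTail : ∀ x ∈ A, (x, g x) ∈ doubleTail X

/-- Invariance of a measure under all holonomies of the double-tail relation of `X`. -/
def IsDoubleTailInvariant {S : Type*} [MeasurableSpace S] (X : Set (ℤ → S))
    (μ : Measure (ℤ → S)) : Prop :=
  ∀ (A : Set (ℤ → S)) (g : (ℤ → S) → (ℤ → S)), IsHolonomy X A g → μ A = μ (g '' A)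

/-! ## The Dyck shift -/

/-- The alphabet `{α₁, …, αₘ} ∪ {β₁, …, βₘ}`, with the discrete σ-algebra. -/
abbrev Letter (m : ℕ) : Type := Fin m ⊕ Fin m

/-- The opening letter `αⱼ`. -/
def α {m : ℕ} (j : Fin m) : Letter m := Sum.inl j

/-- The closing letter `βⱼ`. -/
def β {m : ℕ} (j : Fin m) : Letter m := Sum.inr j

/-- A word over the alphabet, as an element of the free monoid with zero. -/
def word {m : ℕ} (w : List (Letter m)) : WithZero (FreeMonoid (Letter m)) :=
  (FreeMonoid.ofList w : FreeMonoid (Letter m))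

/-- The defining relations of the Dyck monoid: `αⱼ βⱼ ≡ 1` and `αᵢ βⱼ ≡ 0` for `i ≠ j`. -/
inductive DyckRel (m : ℕ) :
    WithZero (FreeMonoid (Letter m)) → WithZero (FreeMonoid (Letter m)) → Prop
  | cancel (j : Fin m) : DyckRel m (word [α j, β j]) 1
  | clash (i j : Fin m) (h : i ≠ j) : DyckRel m (word [α i, β j]) 0

/-- Congruence modulo the Dyck monoid; the monoid itself is the quotient `(dyckCon m).Quotient`. -/
def dyckCon (m : ℕ) : Con (WithZero (FreeMonoid (Letter m))) := conGen (DyckRel m)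

/-- The Dyck language: the words that are not `≡ 0` modulo the Dyck monoid. -/
def language (m : ℕ) : Set (List (Letter m)) := {w | ¬ dyckCon m (word w) 0}

/-- The block `x_r x_{r+1} … x_l`. -/
def block {m : ℕ} (x : ℤ → Letter m) (r l : ℤ) : List (Letter m) :=
  (List.range (l + 1 - r).toNat).map fun k => x (r + k)

/-- The two-sided Dyck shift. -/
def shiftSpace (m : ℕ) : Set (ℤ → Letter m) :=
  {x | ∀ r l : ℤ, r ≤ l → block x r l ∈ language m}

/-! ## Heights -/

/-- The sums `∑_{0 ≤ j < i} f j` for `i ≥ 0` and `-∑_{i ≤ j < 0} f j` for `i < 0`. -/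
def cocycle (f : ℤ → ℤ) (i : ℤ) : ℤ :=
  if 0 ≤ i then ∑ j ∈ Finset.Ico 0 i, f j else -∑ j ∈ Finset.Ico i 0, f j

/-- The height `H_i(x)`: every `α` counts `+1` and every `β` counts `-1`. -/
def height {m : ℕ} (x : ℤ → Letter m) : ℤ → ℤ :=
  cocycle fun j => Sum.elim (fun _ => 1) (fun _ => -1) (x j)

/-- `B^s_t`: the points of the Dyck shift whose heights have their lower limit in `s` at `+∞` and
in `t` at `-∞`, lower limits being taken in the extended reals. -/
def B (m : ℕ) (s t : Set EReal) : Set (ℤ → Letter m) :=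
  {x | x ∈ shiftSpace m ∧
    liminf (fun i : ℤ => ((height x i : ℝ) : EReal)) atTop ∈ s ∧
    liminf (fun i : ℤ => ((height x i : ℝ) : EReal)) atBot ∈ t}

/-! ## The measure `μ̃` -/

/-- The height `H̃_i(z)` of a `0`-`1` sequence: every `1` counts `+1` and every `0` counts `-1`. -/
def bitHeight (z : ℤ → Fin 2) : ℤ → ℤ :=
  cocycle fun j => if z j = 1 then 1 else -1

/-- `S`: the `0`-`1` sequences whose heights have lower limit `-∞` in both directions. -/
def S : Set (ℤ → Fin 2) :=
  {z | liminf (fun i : ℤ => ((bitHeight z i : ℝ) : EReal)) atTop = ⊥ ∧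
    liminf (fun i : ℤ => ((bitHeight z i : ℝ) : EReal)) atBot = ⊥}

/-- `γ_k(z)`: the signed number of ones of `z` in `[0, k]`, respectively `[k, -1]`. -/
def γ (z : ℤ → Fin 2) (k : ℤ) : ℤ :=
  if 0 ≤ k then ∑ i ∈ Finset.Icc 0 k, ((z i : ℕ) : ℤ) else -∑ i ∈ Finset.Icc k (-1), ((z i : ℕ) : ℤ)

/-- `ε_n(z) = max {l < n : H̃_l(z) ≤ H̃_{n+1}(z)}`. For `z ∈ S` this set is nonempty, and it is
bounded above by `n`, so that the supremum is a maximum. -/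
def ε (z : ℤ → Fin 2) (n : ℤ) : ℤ :=
  sSup {l : ℤ | l < n ∧ bitHeight z l ≤ bitHeight z (n + 1)}

/-- The map `F`; only its values for `z ∈ S` matter. -/
def F {m : ℕ} (p : (ℤ → Fin 2) × (ℤ → Fin m)) (n : ℤ) : Letter m :=
  if p.1 n = 1 then α (p.2 (γ p.1 n)) else β (p.2 (γ p.1 (ε p.1 n)))

/-- The symmetric product measure on `{0,1}^ℤ`. -/
def μ₁ : Measure (ℤ → Fin 2) := Measure.infinitePi fun _ => uniformOn Set.univ

/-- The symmetric product measure on `{1,…,m}^ℤ`. -/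
def μ₂ (m : ℕ) : Measure (ℤ → Fin m) := Measure.infinitePi fun _ => uniformOn Set.univ

/-- `μ̃`: the image of `μ₁ × μ₂` under `F`, whose domain is `S × {1,…,m}^ℤ`. -/
def μTilde (m : ℕ) : Measure (ℤ → Letter m) :=
  ((μ₁.prod (μ₂ m)).restrict (S ×ˢ Set.univ)).map F

end DyckShift

end

noncomputable section
namespace DyckShift

/-! ## The Dyck language and stacks -/

/-! A word is nonzero in the Dyck monoid iff it can be read on some infinite stack, an `α` pushing
and a `β` popping (`mem_language_iff`). So when the heights are unbounded below on both sides, every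
closing letter is matched with an earlier opening letter of the same type. A point of `B m {⊥} {⊥}`
is then a bit sequence together with a free choice of types at its ones (`code`,
`code_eq_of_mem_B`). In these coordinates `μTilde m` is `codeMeasure m μ₁`, fair bits with
independent uniform types, since `γ` merely numbers the ones (`μTilde_eq_codeMeasure`).

Uniqueness: permuting the coordinates of a finite window and adding a finitely supported sequence to
the types (`act`) leaves the matching far away untouched, so it is a holonomy (`isHolonomy_act`).
Invariance under adding types forces independent uniform types over the law of the bits
(`eq_codeMeasure`). Invariance under permutations makes the bits exchangeable. By a second-moment
bound, exchangeable signs have an asymptotic mean, the same on the right and on the left. A positive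
mean would keep the heights nonnegative far to the right, a negative one far to the left; so the
mean is zero, and this forces fair coins (`Exchangeable.eq_μ₁`).

Invariance: `codeMeasure m μ₁` is preserved by every `act`. Two tail-equivalent points of `B m {⊥}
{⊥}` with equally many ones in the window are related by one of countably many such changes, so on
these points a holonomy is piecewise an `act` (`codeMeasure_eq_of_cover`). If the numbers of ones
differ, the heights on the right are shifted relative to those on the left. Each deep closing letter
on the right is then matched, in the two points, with two different opening letters on the left,
whose types must agree. This holds along infinitely many levels, which has probability zero for `m >
1` (`codeMeasure_shifted`). -/

/-- The infinite stack `s` with `j` pushed on top. -/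
def push {m : ℕ} (j : Fin m) (s : ℕ → Fin m) : ℕ → Fin m
  | 0 => j
  | k + 1 => s k

/-- Reading one letter on an infinite stack: `αⱼ` pushes `j`, and `βⱼ` pops `j`. -/
def step {m : ℕ} (s : ℕ → Fin m) : Letter m → Option (ℕ → Fin m)
  | Sum.inl j => some (push j s)
  | Sum.inr j => if s 0 = j then some fun k => s (k + 1) else none

/-- Reading a word on an infinite stack. -/
def run {m : ℕ} (w : List (Letter m)) (s : ℕ → Fin m) : Option (ℕ → Fin m) :=
  w.foldlM step s

@[simp] theorem run_nil {m : ℕ} (s : ℕ → Fin m) : run [] s = some s := rfl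

theorem run_append {m : ℕ} (v w : List (Letter m)) (s : ℕ → Fin m) :
    run (v ++ w) s = (run v s).bind (run w) := by
  simp only [run, List.foldlM_append]
  rfl

theorem run_cons {m : ℕ} (a : Letter m) (w : List (Letter m)) (s : ℕ → Fin m) :
    run (a :: w) s = (step s a).bind (run w) := by
  simp only [run, List.foldlM_cons]
  rfl

theorem run_singleton {m : ℕ} (a : Letter m) (s : ℕ → Fin m) : run [a] s = step s a := by
  rw [run_cons]
  cases step s a <;> rfl

/-- The action of the free monoid with zero on infinite stacks. -/
def stackAct {m : ℕ} (a : WithZero (FreeMonoid (Letter m))) (s : ℕ → Fin m) :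
    Option (ℕ → Fin m) :=
  WithZero.recZeroCoe none (fun w => run (FreeMonoid.toList w) s) a

@[simp] theorem stackAct_zero {m : ℕ} (s : ℕ → Fin m) :
    stackAct (0 : WithZero (FreeMonoid (Letter m))) s = none := rfl

@[simp] theorem stackAct_word {m : ℕ} (w : List (Letter m)) (s : ℕ → Fin m) :
    stackAct (word w) s = run w s := rfl

theorem stackAct_mul {m : ℕ} (a b : WithZero (FreeMonoid (Letter m))) (s : ℕ → Fin m) :
    stackAct (a * b) s = (stackAct a s).bind (stackAct b) := by
  induction a with
  | zero => simp
  | coe a =>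
    induction b with
    | zero =>
      rw [mul_zero]
      cases h : stackAct (a : WithZero (FreeMonoid (Letter m))) s <;> rfl
    | coe b => exact run_append (FreeMonoid.toList a) (FreeMonoid.toList b) s

/-- Two elements are identified when they act alike on infinite stacks. -/
def stackCon (m : ℕ) : Con (WithZero (FreeMonoid (Letter m))) where
  r a b := ∀ s, stackAct a s = stackAct b s
  iseqv := ⟨fun _ _ => rfl, fun h s => (h s).symm, fun h h' s => (h s).trans (h' s)⟩
  mul' := by
    intro a b c d hab hcd s
    rw [stackAct_mul, stackAct_mul, hab s]
    congr 1
    exact funext hcd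

/-- Pushing `i` and then popping `j` does nothing if `i = j` and fails otherwise, so both defining
relations hold for the stack action. A word that runs on some stack is therefore nonzero. -/
theorem dyckCon_le_stackCon (m : ℕ) : dyckCon m ≤ stackCon m := by
  refine Con.conGen_le.2 fun a b h => ?_
  cases h with
  | cancel j =>
    intro s
    change run [α j, β j] s = some s
    simp [run_cons, step, α, β, push]
  | clash i j h =>
    intro s
    change run [α i, β j] s = none
    simp [run_cons, step, α, β, push, h]

theorem word_append {m : ℕ} (v w : List (Letter m)) : word (v ++ w) = word v * word w := rfl

/-- A new `α` extends the normal form on the right. A new `β` cancels or clashes with the last `α`,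
or, if there is none, joins the block of `β`s. -/
theorem word_normalForm {m : ℕ} (w : List (Letter m)) :
    dyckCon m (word w) 0 ∨
      ∃ u v : List (Fin m), dyckCon m (word w) (word (u.map β ++ v.map α)) := by
  induction w using List.reverseRecOn with
  | nil => exact Or.inr ⟨[], [], (dyckCon m).refl _⟩
  | append_singleton w a ih =>
    rcases ih with h | ⟨u, v, h⟩
    · left
      have := (dyckCon m).mul h ((dyckCon m).refl (word [a]))
      rwa [zero_mul] at this
    · have h' := (dyckCon m).mul h ((dyckCon m).refl (word [a]))
      rw [← word_append, ← word_append] at h'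
      rcases a with j | j
      · refine Or.inr ⟨u, v ++ [j], ?_⟩
        simpa [α] using h'
      · rcases List.eq_nil_or_concat v with rfl | ⟨v', i, rfl⟩
        · refine Or.inr ⟨u ++ [j], [], ?_⟩
          simpa [β] using h'
        · have e : List.map β u ++ List.map α (v'.concat i) ++ [Sum.inr j] =
              (List.map β u ++ List.map α v') ++ [α i, β j] := by
            simp [β]
          rw [e, word_append (List.map β u ++ List.map α v')] at h'
          by_cases hij : i = j
          · subst hij
            refine Or.inr ⟨u, v', (dyckCon m).trans h' ?_⟩
            have := (dyckCon m).mul ((dyckCon m).refl (word (List.map β u ++ List.map α v')))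
              (ConGen.Rel.of _ _ (DyckRel.cancel i))
            rwa [mul_one] at this
          · refine Or.inl ((dyckCon m).trans h' ?_)
            have := (dyckCon m).mul ((dyckCon m).refl (word (List.map β u ++ List.map α v')))
              (ConGen.Rel.of _ _ (DyckRel.clash i j hij))
            rwa [mul_zero] at this

theorem exists_run_map_β {m : ℕ} (u : List (Fin m)) (s : ℕ → Fin m) :
    ∃ t, run (u.map β) t = some s := by
  induction u with
  | nil => exact ⟨s, rfl⟩
  | cons j u ih =>
    obtain ⟨t, ht⟩ := ih
    refine ⟨push j t, ?_⟩
    simpa [run_cons, step, β, push] using ht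

theorem exists_run_map_α {m : ℕ} (v : List (Fin m)) (s : ℕ → Fin m) :
    ∃ t, run (v.map α) s = some t := by
  induction v generalizing s with
  | nil => exact ⟨s, rfl⟩
  | cons j v ih => simpa [run_cons, step, α] using ih (push j s)

/-- A word belongs to the Dyck language iff it can be read on some infinite stack. -/
theorem mem_language_iff {m : ℕ} [NeZero m] (w : List (Letter m)) :
    w ∈ language m ↔ ∃ s t, run w s = some t := by
  constructor
  · intro hw
    rcases word_normalForm w with h | ⟨u, v, h⟩
    · exact absurd h hw
    · obtain ⟨s, hs⟩ := exists_run_map_β u (fun _ => 0)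
      obtain ⟨t, ht⟩ := exists_run_map_α v (fun _ => 0)
      refine ⟨s, t, ?_⟩
      have := dyckCon_le_stackCon m h s
      rw [stackAct_word, stackAct_word] at this
      rw [this, run_append, hs]
      exact ht
  · rintro ⟨s, t, h⟩ h0
    have := dyckCon_le_stackCon m h0 s
    rw [stackAct_word, stackAct_zero, h] at this
    cases this

theorem block_eq {m : ℕ} (x : ℤ → Letter m) (r : ℤ) (n : ℕ) :
    block x r (r + n) = block x r (r + n - 1) ++ [x (r + n)] := by
  have h1 : (r + n + 1 - r).toNat = n + 1 := by omega
  simp [block, h1, List.range_succ]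

theorem block_eq_nil {m : ℕ} (x : ℤ → Letter m) (r : ℤ) : block x r (r - 1) = [] := by
  simp [block]

/-- Reading a block is following a sequence of stacks. -/
theorem exists_run_block_iff {m : ℕ} (x : ℤ → Letter m) (r : ℤ) (n : ℕ) :
    (∃ s t, run (block x r (r + n - 1)) s = some t) ↔
      ∃ st : ℤ → ℕ → Fin m, ∀ k, r ≤ k → k < r + n → step (st k) (x k) = some (st (k + 1)) := by
  have key : ∀ n : ℕ, ∀ s t, run (block x r (r + n - 1)) s = some t →
      ∃ st : ℤ → ℕ → Fin m, st (r + n) = t ∧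
        ∀ k, r ≤ k → k < r + n → step (st k) (x k) = some (st (k + 1)) := by
    intro n
    induction n with
    | zero => exact fun s t _ => ⟨fun _ => t, rfl, fun k h h' => by simp at h'; omega⟩
    | succ n ih =>
      intro s t h
      have e : r + ((n + 1 : ℕ) : ℤ) - 1 = r + n := by push_cast; ring
      rw [e, block_eq, run_append] at h
      cases h1 : run (block x r (r + n - 1)) s with
      | none => simp [h1] at h
      | some t' =>
        obtain ⟨st, hst, hs⟩ := ih s t' h1
        rw [h1, Option.bind_some, run_singleton] at h
        refine ⟨fun k => if k = r + n + 1 then t else st k, by simp [add_assoc], ?_⟩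
        intro k hk hk'
        push_cast at hk'
        rcases (show k ≤ r + n by omega).lt_or_eq with hlt | rfl
        · have e1 : k ≠ r + n + 1 := by omega
          have e2 : k ≠ r + n := by omega
          simpa [e1, e2] using hs k hk hlt
        · simpa [hst] using h
  constructor
  · rintro ⟨s, t, h⟩
    obtain ⟨st, -, hst⟩ := key n s t h
    exact ⟨st, hst⟩
  · rintro ⟨st, hst⟩
    refine ⟨st r, st (r + n), ?_⟩
    induction n with
    | zero => simp [block_eq_nil]
    | succ n ih =>
      have e : r + ((n + 1 : ℕ) : ℤ) - 1 = r + n := by push_cast; ring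
      rw [e, block_eq, run_append, ih fun k h h' => hst k h (by push_cast; omega),
        Option.bind_some, run_singleton, hst (r + n) (by omega) (by push_cast; omega)]
      push_cast
      rw [add_assoc]

/-- A point belongs to the Dyck shift iff each window can be read along a sequence of stacks. -/
theorem mem_shiftSpace_iff {m : ℕ} [NeZero m] (x : ℤ → Letter m) :
    x ∈ shiftSpace m ↔ ∀ r : ℤ, ∀ n : ℕ, ∃ st : ℤ → ℕ → Fin m,
      ∀ k, r ≤ k → k < r + n → step (st k) (x k) = some (st (k + 1)) := by
  constructor
  · intro hx r n
    rw [← exists_run_block_iff, ← mem_language_iff]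
    cases n with
    | zero =>
      rw [mem_language_iff]
      exact ⟨fun _ => 0, fun _ => 0, by simp [block_eq_nil]⟩
    | succ n => exact hx _ _ (by push_cast; omega)
  · intro h r l hrl
    have e : l = r + ((l + 1 - r).toNat : ℤ) - 1 := by omega
    rw [e, mem_language_iff, exists_run_block_iff]
    exact h _ _

/-! ## Heights and matching -/

/-- The bit `1` counts `+1`, the bit `0` counts `-1`. -/
def sgn (b : Fin 2) : ℤ := if b = 1 then 1 else -1

theorem sgn_one : sgn 1 = 1 := rfl

theorem sgn_zero : sgn 0 = -1 := rfl

theorem fin_two_cases (b : Fin 2) : b = 0 ∨ b = 1 := by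
  fin_cases b <;> simp

theorem cocycle_zero (f : ℤ → ℤ) : cocycle f 0 = 0 := by simp [cocycle]

theorem cocycle_succ (f : ℤ → ℤ) (i : ℤ) : cocycle f (i + 1) = cocycle f i + f i := by
  unfold cocycle
  rcases lt_trichotomy i (-1) with h | rfl | h
  · have h1 : ¬ 0 ≤ i := by omega
    have h2 : ¬ 0 ≤ i + 1 := by omega
    have h3 : Finset.Ico i 0 = insert i (Finset.Ico (i + 1) 0) := by
      ext k; simp only [Finset.mem_Ico, Finset.mem_insert]; omega
    rw [if_neg h1, if_neg h2, h3, Finset.sum_insert (by simp)]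
    ring
  · have h3 : Finset.Ico (-1 : ℤ) 0 = {-1} := by
      ext k; simp only [Finset.mem_Ico, Finset.mem_singleton]; omega
    simp [h3]
  · have h1 : 0 ≤ i := by omega
    have h2 : 0 ≤ i + 1 := by omega
    have h3 : Finset.Ico 0 (i + 1) = insert i (Finset.Ico 0 i) := by
      ext k; simp only [Finset.mem_Ico, Finset.mem_insert]; omega
    rw [if_pos h1, if_pos h2, h3, Finset.sum_insert (by simp)]
    ring

theorem bitHeight_zero (z : ℤ → Fin 2) : bitHeight z 0 = 0 := cocycle_zero _

theorem bitHeight_succ (z : ℤ → Fin 2) (i : ℤ) :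
    bitHeight z (i + 1) = bitHeight z i + sgn (z i) := cocycle_succ _ i

theorem bitHeight_succ_of_one {z : ℤ → Fin 2} {i : ℤ} (h : z i = 1) :
    bitHeight z (i + 1) = bitHeight z i + 1 := by rw [bitHeight_succ, h, sgn_one]

theorem bitHeight_succ_of_zero {z : ℤ → Fin 2} {i : ℤ} (h : z i = 0) :
    bitHeight z (i + 1) = bitHeight z i - 1 := by rw [bitHeight_succ, h, sgn_zero]; ring

theorem bitHeight_sub (z : ℤ → Fin 2) {a b : ℤ} (hab : a ≤ b) :
    bitHeight z b - bitHeight z a = ∑ i ∈ Finset.Ico a b, sgn (z i) := by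
  induction b, hab using Int.leInduction with
  | base => simp
  | succ b hab ih =>
    have h3 : Finset.Ico a (b + 1) = insert b (Finset.Ico a b) := by
      ext k; simp only [Finset.mem_Ico, Finset.mem_insert]; omega
    rw [h3, Finset.sum_insert (by simp), ← ih, bitHeight_succ]
    ring

/-! ### Lower limits and unboundedness of heights -/

theorem liminf_eq_bot_iff {f : Filter ℤ} (h : ℤ → ℤ) :
    liminf (fun i : ℤ => ((h i : ℝ) : EReal)) f = ⊥ ↔ ∀ M : ℤ, ∃ᶠ i in f, h i ≤ M := by
  constructor
  · intro hl M
    by_contra hM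
    rw [not_frequently] at hM
    have : ((M : ℝ) : EReal) ≤ liminf (fun i : ℤ => ((h i : ℝ) : EReal)) f := by
      refine le_liminf_of_le (by isBoundedDefault) ?_
      filter_upwards [hM] with i hi
      exact_mod_cast (not_le.1 hi).le
    rw [hl] at this
    exact absurd this (by simp)
  · intro hM
    rw [EReal.eq_bot_iff_forall_lt]
    intro y
    obtain ⟨M, hMy⟩ := exists_int_lt y
    refine lt_of_le_of_lt (liminf_le_of_frequently_le ?_ (by isBoundedDefault))
      (show ((M : ℝ) : EReal) < y by exact_mod_cast hMy)
    exact (hM M).mono fun i hi => by exact_mod_cast hi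

/-- Heights that are unbounded below in both directions. -/
def Unbounded (h : ℤ → ℤ) : Prop :=
  (∀ M N : ℤ, ∃ i, N ≤ i ∧ h i ≤ M) ∧ ∀ M N : ℤ, ∃ i, i ≤ N ∧ h i ≤ M

theorem liminf_eq_bot_and_iff (h : ℤ → ℤ) :
    (liminf (fun i : ℤ => ((h i : ℝ) : EReal)) atTop = ⊥ ∧
      liminf (fun i : ℤ => ((h i : ℝ) : EReal)) atBot = ⊥) ↔ Unbounded h := by
  rw [liminf_eq_bot_iff, liminf_eq_bot_iff]
  simp only [frequently_atTop, frequently_atBot]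
  rfl

theorem mem_S_iff (z : ℤ → Fin 2) : z ∈ S ↔ Unbounded (bitHeight z) := liminf_eq_bot_and_iff _

/-- The last time before `n` at which the height is at most `h`. -/
def prev (z : ℤ → Fin 2) (n h : ℤ) : ℤ := sSup {l : ℤ | l < n ∧ bitHeight z l ≤ h}

theorem ε_eq_prev (z : ℤ → Fin 2) (n : ℤ) : ε z n = prev z n (bitHeight z (n + 1)) := rfl

theorem prev_eq {z : ℤ → Fin 2} {n h p : ℤ} (hp : p < n) (hh : bitHeight z p ≤ h)
    (hl : ∀ l, p < l → l < n → h < bitHeight z l) : prev z n h = p := by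
  refine IsGreatest.csSup_eq ⟨⟨hp, hh⟩, fun l hl' => ?_⟩
  by_contra hpl
  exact absurd hl'.2 (not_le.2 (hl l (not_le.1 hpl) hl'.1))

theorem prev_mem {z : ℤ → Fin 2} (hz : Unbounded (bitHeight z)) (n h : ℤ) :
    prev z n h < n ∧ bitHeight z (prev z n h) ≤ h := by
  obtain ⟨i, hi, hi'⟩ := hz.2 h (n - 1)
  exact Int.csSup_mem (s := {l : ℤ | l < n ∧ bitHeight z l ≤ h}) ⟨i, by omega, hi'⟩
    ⟨n, fun l hl => hl.1.le⟩

theorem lt_bitHeight_of_prev_lt {z : ℤ → Fin 2} {n h l : ℤ} (hl : prev z n h < l) (hn : l < n) :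
    h < bitHeight z l := by
  by_contra hlt
  exact absurd (le_csSup (s := {l : ℤ | l < n ∧ bitHeight z l ≤ h}) ⟨n, fun l hl => hl.1.le⟩
    ⟨hn, not_lt.1 hlt⟩) (not_le.2 hl)

/-- With the two lemmas that follow: steps are `±1`, so the last visit to `(-∞, h]` before a time
above `h` is at height exactly `h` and is left by an up-step. -/
theorem lt_bitHeight_prev_succ {z : ℤ → Fin 2} (hz : Unbounded (bitHeight z)) {n h : ℤ}
    (hn : h < bitHeight z n) : h < bitHeight z (prev z n h + 1) := by
  rcases (show prev z n h + 1 ≤ n from (prev_mem hz n h).1).lt_or_eq with hlt | heq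
  · exact lt_bitHeight_of_prev_lt (by omega) hlt
  · rwa [heq]

theorem prev_eq_one {z : ℤ → Fin 2} (hz : Unbounded (bitHeight z)) {n h : ℤ}
    (hn : h < bitHeight z n) : z (prev z n h) = 1 := by
  have h1 := lt_bitHeight_prev_succ hz hn
  have h2 := (prev_mem hz n h).2
  rcases fin_two_cases (z (prev z n h)) with h0 | h0
  · rw [bitHeight_succ_of_zero h0] at h1
    omega
  · exact h0

theorem bitHeight_prev {z : ℤ → Fin 2} (hz : Unbounded (bitHeight z)) {n h : ℤ}
    (hn : h < bitHeight z n) : bitHeight z (prev z n h) = h := by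
  have h1 := lt_bitHeight_prev_succ hz hn
  have h2 := (prev_mem hz n h).2
  rw [bitHeight_succ_of_one (prev_eq_one hz hn)] at h1
  omega

theorem prev_succ {z : ℤ → Fin 2} {n h : ℤ} (hn : h < bitHeight z n) :
    prev z (n + 1) h = prev z n h := by
  unfold prev
  congr 1
  ext l
  simp only [Set.mem_ofPred_eq]
  constructor
  · rintro ⟨h1, h2⟩
    refine ⟨?_, h2⟩
    rcases (show l ≤ n by omega).lt_or_eq with h3 | rfl
    · exact h3
    · omega
  · rintro ⟨h1, h2⟩
    exact ⟨by omega, h2⟩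

theorem ε_eq_one {z : ℤ → Fin 2} (hz : Unbounded (bitHeight z)) {n : ℤ} (hn : z n = 0) :
    z (ε z n) = 1 :=
  prev_eq_one hz (by rw [bitHeight_succ_of_zero hn]; omega)

theorem ε_lt {z : ℤ → Fin 2} (hz : Unbounded (bitHeight z)) (n : ℤ) : ε z n < n :=
  (prev_mem hz n _).1

theorem bitHeight_ε_le {z : ℤ → Fin 2} (hz : Unbounded (bitHeight z)) (n : ℤ) :
    bitHeight z (ε z n) ≤ bitHeight z (n + 1) :=
  (prev_mem hz n _).2

theorem bitHeight_ε {z : ℤ → Fin 2} (hz : Unbounded (bitHeight z)) {n : ℤ} (hn : z n = 0) :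
    bitHeight z (ε z n) = bitHeight z (n + 1) :=
  bitHeight_prev hz (by rw [bitHeight_succ_of_zero hn]; omega)

theorem lt_bitHeight_of_ε_lt {z : ℤ → Fin 2} {n l : ℤ} (hl : ε z n < l) (hn : l < n) :
    bitHeight z (n + 1) < bitHeight z l :=
  lt_bitHeight_of_prev_lt hl hn

/-! ## Coordinates on the Dyck shift -/

/-- The bits of a point: opening letters are `1`, closing letters are `0`. -/
def bits {m : ℕ} (x : ℤ → Letter m) (n : ℤ) : Fin 2 := Sum.elim (fun _ => 1) (fun _ => 0) (x n)

/-- The types of the letters of a point. -/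
def typ {m : ℕ} (x : ℤ → Letter m) (n : ℤ) : Fin m := Sum.elim id id (x n)

/-- The point with bits `z` whose opening letter at `n` has type `t n` and whose closing letters
have the types of the matching opening letters. -/
def code {m : ℕ} (z : ℤ → Fin 2) (t : ℤ → Fin m) (n : ℤ) : Letter m :=
  if z n = 1 then α (t n) else β (t (ε z n))

theorem eq_α_of_bits {m : ℕ} {x : ℤ → Letter m} {n : ℤ} (h : bits x n = 1) : x n = α (typ x n) := by
  unfold bits at h
  unfold typ
  generalize x n = a at h ⊢
  rcases a with j | j
  · rfl
  · simp at h

theorem eq_β_of_bits {m : ℕ} {x : ℤ → Letter m} {n : ℤ} (h : bits x n = 0) : x n = β (typ x n) := by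
  unfold bits at h
  unfold typ
  generalize x n = a at h ⊢
  rcases a with j | j
  · simp at h
  · rfl

theorem height_eq {m : ℕ} (x : ℤ → Letter m) : height x = bitHeight (bits x) := by
  unfold height bitHeight
  congr 1
  ext j
  unfold bits
  rcases x j with a | a <;> simp

theorem code_of_one {m : ℕ} {z : ℤ → Fin 2} (t : ℤ → Fin m) {n : ℤ} (h : z n = 1) :
    code z t n = α (t n) := if_pos h

theorem code_of_zero {m : ℕ} {z : ℤ → Fin 2} (t : ℤ → Fin m) {n : ℤ} (h : z n = 0) :
    code z t n = β (t (ε z n)) := if_neg (by rw [h]; decide)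

@[simp] theorem bits_code {m : ℕ} (z : ℤ → Fin 2) (t : ℤ → Fin m) : bits (code z t) = z := by
  ext n
  rcases fin_two_cases (z n) with h | h
  · simp [bits, code_of_zero t h, β, h]
  · simp [bits, code_of_one t h, α, h]

theorem typ_code_of_one {m : ℕ} {z : ℤ → Fin 2} (t : ℤ → Fin m) {n : ℤ} (h : z n = 1) :
    typ (code z t) n = t n := by
  simp [typ, code_of_one t h, α]

/-- Only the types of the opening letters matter. -/
theorem code_congr {m : ℕ} {z : ℤ → Fin 2} (hz : Unbounded (bitHeight z)) {t t' : ℤ → Fin m}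
    (h : ∀ n, z n = 1 → t n = t' n) : code z t = code z t' := by
  ext1 n
  rcases fin_two_cases (z n) with hn | hn
  · rw [code_of_zero t hn, code_of_zero t' hn, h _ (ε_eq_one hz hn)]
  · rw [code_of_one t hn, code_of_one t' hn, h n hn]

/-- The stack at time `k` carries at depth `j` the type found at the last earlier time of height at
most `H_k - 1 - j`. No unboundedness is needed: where `prev` takes its default value, letters and
stacks use the same one. -/
theorem code_mem_shiftSpace {m : ℕ} [NeZero m] (z : ℤ → Fin 2) (t : ℤ → Fin m) :
    code z t ∈ shiftSpace m := by
  rw [mem_shiftSpace_iff]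
  intro r n
  refine ⟨fun k j => t (prev z k (bitHeight z k - 1 - j)), fun k _ _ => ?_⟩
  rcases fin_two_cases (z k) with hk | hk
  · rw [code_of_zero t hk]
    have h1 : t (prev z k (bitHeight z k - 1 - (0 : ℕ))) = t (ε z k) := by
      rw [ε_eq_prev, bitHeight_succ_of_zero hk]
      simp
    simp only [step, β]
    rw [if_pos h1]
    congr 1
    ext1 j
    rw [prev_succ (by rw [bitHeight_succ_of_zero hk]; omega), bitHeight_succ_of_zero hk]
    congr 2
    push_cast
    ring
  · rw [code_of_one t hk]
    simp only [step, α]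
    congr 1
    ext1 j
    cases j with
    | zero =>
      rw [prev_eq (p := k) (by omega) (by rw [bitHeight_succ_of_one hk]; simp)
        (fun l h1 h2 => by omega)]
      rfl
    | succ j =>
      rw [prev_succ (by rw [bitHeight_succ_of_one hk]; push_cast; omega), bitHeight_succ_of_one hk]
      change t _ = t _
      congr 2
      push_cast
      ring

/-- In a point of the Dyck shift, a closing letter has the type of the matching opening letter. -/
theorem typ_ε_of_mem_shiftSpace {m : ℕ} [NeZero m] {x : ℤ → Letter m} (hx : x ∈ shiftSpace m)
    (hz : Unbounded (bitHeight (bits x))) {n : ℤ} (hn : bits x n = 0) :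
    typ x (ε (bits x) n) = typ x n := by
  set z := bits x with hzdef
  set l := ε z n with hl
  have hln : l < n := ε_lt hz n
  obtain ⟨st, hst⟩ := (mem_shiftSpace_iff x).1 hx l (n - l + 1).toNat
  have hl1 : z l = 1 := ε_eq_one hz hn
  have hH := bitHeight_ε hz hn
  rw [← hl] at hH
  have hl' := bitHeight_succ_of_one hl1
  -- Strictly between `l` and `n` the height stays above `H_{n+1}`, so the symbol pushed at `l` is
  -- not popped before `n`; it sits at depth `H_k - H_{l+1}`.
  have key : ∀ k, l + 1 ≤ k → k ≤ n →
      st k (bitHeight z k - bitHeight z (l + 1)).toNat = typ x l := by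
    intro k hk
    induction k, hk using Int.leInduction with
    | base =>
      intro _
      have := hst l le_rfl (by omega)
      rw [eq_α_of_bits hl1] at this
      simp only [step, α, Option.some.injEq] at this
      rw [← this, sub_self]
      rfl
    | succ k hk ih =>
      intro hkn
      have ih := ih (by omega)
      have hs := hst k (by omega) (by omega)
      have hHk : bitHeight z (l + 1) ≤ bitHeight z (k + 1) := by
        rcases hkn.lt_or_eq with h | h
        · have := lt_bitHeight_of_ε_lt (z := z) (n := n) (l := k + 1) (by omega) h
          omega
        · rw [h]
          have := bitHeight_succ_of_zero hn
          omega
      have hHk' : bitHeight z (l + 1) ≤ bitHeight z k := by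
        have := lt_bitHeight_of_ε_lt (z := z) (n := n) (l := k) (by omega) (by omega)
        omega
      rcases fin_two_cases (z k) with h0 | h1
      · rw [eq_β_of_bits h0] at hs
        simp only [step, β] at hs
        split_ifs at hs with h
        simp only [Option.some.injEq] at hs
        rw [bitHeight_succ_of_zero h0] at hHk ⊢
        rw [← hs, ← ih]
        change st k _ = _
        congr 1
        omega
      · rw [eq_α_of_bits h1] at hs
        simp only [step, α, Option.some.injEq] at hs
        rw [bitHeight_succ_of_one h1, ← hs, ← ih]
        have e : (bitHeight z k + 1 - bitHeight z (l + 1)).toNat =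
          (bitHeight z k - bitHeight z (l + 1)).toNat + 1 := by omega
        rw [e]
        rfl
  have h1 := key n (by omega) le_rfl
  have h2 : bitHeight z n - bitHeight z (l + 1) = 0 := by
    have := bitHeight_succ_of_zero hn
    omega
  rw [h2] at h1
  have hs := hst n (by omega) (by omega)
  rw [eq_β_of_bits hn] at hs
  simp only [step, β] at hs
  split_ifs at hs with h
  rw [← h1, ← h]
  rfl

theorem code_bits_typ {m : ℕ} [NeZero m] {x : ℤ → Letter m} (hx : x ∈ shiftSpace m)
    (hz : Unbounded (bitHeight (bits x))) : code (bits x) (typ x) = x := by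
  ext1 n
  rcases fin_two_cases (bits x n) with h | h
  · rw [code_of_zero _ h, typ_ε_of_mem_shiftSpace hx hz h, ← eq_β_of_bits h]
  · rw [code_of_one _ h, ← eq_α_of_bits h]

theorem mem_B_iff {m : ℕ} (x : ℤ → Letter m) :
    x ∈ B m {⊥} {⊥} ↔ x ∈ shiftSpace m ∧ Unbounded (bitHeight (bits x)) := by
  rw [← height_eq, ← liminf_eq_bot_and_iff]
  rfl

theorem code_mem_B {m : ℕ} [NeZero m] {z : ℤ → Fin 2} (hz : Unbounded (bitHeight z))
    (t : ℤ → Fin m) : code z t ∈ B m {⊥} {⊥} := by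
  rw [mem_B_iff, bits_code]
  exact ⟨code_mem_shiftSpace z t, hz⟩

theorem code_eq_of_mem_B {m : ℕ} [NeZero m] {x : ℤ → Letter m} (hx : x ∈ B m {⊥} {⊥}) :
    code (bits x) (typ x) = x := by
  rw [mem_B_iff] at hx
  exact code_bits_typ hx.1 hx.2

/-! ## Changing finitely many coordinates -/

/-- The increments agree off the window, so the difference of heights is constant on each side. The
left range includes `-N`, because the height there does not yet involve the bit at `-N`. -/
theorem exists_bitHeight_shift {z z' : ℤ → Fin 2} {N : ℕ}
    (h : ∀ k : ℤ, (N : ℤ) < |k| → z k = z' k) :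
    ∃ c d : ℤ, (∀ k : ℤ, N < k → bitHeight z' k = bitHeight z k + c) ∧
      (∀ k : ℤ, k ≤ -N → bitHeight z' k = bitHeight z k + d) ∧
      c - d = ∑ i ∈ Finset.Ico (-N : ℤ) (N + 1), sgn (z' i) -
        ∑ i ∈ Finset.Ico (-N : ℤ) (N + 1), sgn (z i) := by
  refine ⟨bitHeight z' (N + 1) - bitHeight z (N + 1), bitHeight z' (-N) - bitHeight z (-N),
    ?_, ?_, ?_⟩
  · intro k hk
    have hk' : (N : ℤ) + 1 ≤ k := hk
    have e : ∑ i ∈ Finset.Ico ((N : ℤ) + 1) k, sgn (z' i) =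
        ∑ i ∈ Finset.Ico ((N : ℤ) + 1) k, sgn (z i) := by
      refine Finset.sum_congr rfl fun i hi => ?_
      rw [Finset.mem_Ico] at hi
      rw [h i (lt_of_lt_of_le (by omega) (le_abs_self i))]
    rw [← bitHeight_sub z hk', ← bitHeight_sub z' hk'] at e
    omega
  · intro k hk
    have e : ∑ i ∈ Finset.Ico k (-N : ℤ), sgn (z' i) =
        ∑ i ∈ Finset.Ico k (-N : ℤ), sgn (z i) := by
      refine Finset.sum_congr rfl fun i hi => ?_
      rw [Finset.mem_Ico] at hi
      rw [h i (lt_of_lt_of_le (by omega) (neg_le_abs i))]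
    rw [← bitHeight_sub z hk, ← bitHeight_sub z' hk] at e
    omega
  · rw [← bitHeight_sub z (by omega), ← bitHeight_sub z' (by omega)]
    ring

theorem Unbounded.congr {z z' : ℤ → Fin 2} {N : ℕ} (hz : Unbounded (bitHeight z))
    (h : ∀ k : ℤ, (N : ℤ) < |k| → z k = z' k) : Unbounded (bitHeight z') := by
  obtain ⟨c, d, hc, hd, -⟩ := exists_bitHeight_shift h
  constructor
  · intro M K
    obtain ⟨i, hi, hi'⟩ := hz.1 (M - c) (max K (N + 1))
    refine ⟨i, (le_max_left _ _).trans hi, ?_⟩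
    rw [hc i (lt_of_lt_of_le (by omega) ((le_max_right _ _).trans hi))]
    omega
  · intro M K
    obtain ⟨i, hi, hi'⟩ := hz.2 (M - d) (min K (-N))
    refine ⟨i, hi.trans (min_le_left _ _), ?_⟩
    rw [hd i (hi.trans (min_le_right _ _))]
    omega

theorem exists_lt_on_window (f : ℤ → ℤ) (N : ℕ) : ∃ h : ℤ, ∀ k : ℤ, |k| ≤ N → h < f k := by
  obtain ⟨b, hb⟩ := ((Finset.Icc (-N : ℤ) N).image f).bddBelow
  refine ⟨b - 1, fun k hk => ?_⟩
  have := hb (Finset.mem_coe.2 (Finset.mem_image_of_mem f (Finset.mem_Icc.2 (abs_le.1 hk))))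
  omega

/-- Far from the window in which two sequences differ, the matching is the same, provided that the
heights agree. -/
theorem exists_ε_eq {z z' : ℤ → Fin 2} {N : ℕ} {c : ℤ} (hz : Unbounded (bitHeight z))
    (hc : ∀ k : ℤ, (N : ℤ) < |k| → bitHeight z' k = bitHeight z k + c) :
    ∃ R : ℕ, N ≤ R ∧ ∀ n : ℤ, (R : ℤ) < |n| → ε z' n = ε z n ∧ (N : ℤ) < |ε z n| := by
  obtain ⟨h₁, hh₁⟩ := exists_lt_on_window (bitHeight z) N
  obtain ⟨h₂, hh₂⟩ := exists_lt_on_window (bitHeight z') N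
  obtain ⟨h, h1, h2⟩ : ∃ h, h ≤ h₁ ∧ h + c ≤ h₂ :=
    ⟨min h₁ (h₂ - c), min_le_left _ _, by have := min_le_right h₁ (h₂ - c); omega⟩
  -- At `r`, right of the window, the height is below everything in the window, for `z` and, up to
  -- `c`, for `z'`. A matching pair straddling `r` closes lower still, so its opening partner is not
  -- in the window and the window cannot intercept it.
  obtain ⟨r, hNr, hr⟩ := hz.1 h (N + 1)
  refine ⟨r.toNat, by omega, fun n hn => ?_⟩
  have hrn : r < |n| := by omega
  have hp1 := ε_lt hz n
  have hp2 := bitHeight_ε_le hz n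
  set p := ε z n with hp
  have hn1 : (N : ℤ) < |n + 1| := by
    rcases abs_cases n with ⟨e, -⟩ | ⟨e, -⟩
    · exact lt_of_lt_of_le (by omega) (le_abs_self _)
    · exact lt_of_lt_of_le (by omega) (neg_le_abs _)
  have hpN : (N : ℤ) < |p| := by
    by_contra hlt
    have h3 := hh₁ p (not_lt.1 hlt)
    rw [not_lt, abs_le] at hlt
    have hn0 : r < n := by
      rcases abs_cases n with ⟨e, -⟩ | ⟨e, -⟩ <;> omega
    have := lt_bitHeight_of_ε_lt (z := z) (n := n) (l := r) (by omega) hn0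
    omega
  refine ⟨prev_eq hp1 (by rw [hc p hpN, hc _ hn1]; omega) fun l hl hln => ?_, hpN⟩
  rw [hc _ hn1]
  by_cases hlN : (N : ℤ) < |l|
  · rw [hc l hlN]
    have := lt_bitHeight_of_ε_lt (z := z) hl hln
    omega
  · have h3 := hh₂ l (not_lt.1 hlN)
    rw [not_lt, abs_le] at hlN
    have hn0 : r < n := by
      rcases abs_cases n with ⟨e, -⟩ | ⟨e, -⟩ <;> omega
    have := lt_bitHeight_of_ε_lt (z := z) (n := n) (l := r) (by omega) hn0
    omega

/-- Equal window sums give equal height shifts on both sides. Far away the matching is then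
unchanged and matched positions lie off the window, where the types agree. -/
theorem exists_code_eq {m : ℕ} {z z' : ℤ → Fin 2} {t t' : ℤ → Fin m} {N : ℕ}
    (hz : Unbounded (bitHeight z)) (h : ∀ k : ℤ, (N : ℤ) < |k| → z k = z' k)
    (ht : ∀ k : ℤ, (N : ℤ) < |k| → t k = t' k)
    (hs : ∑ i ∈ Finset.Ico (-N : ℤ) (N + 1), sgn (z' i) =
      ∑ i ∈ Finset.Ico (-N : ℤ) (N + 1), sgn (z i)) :
    ∃ R : ℕ, ∀ n : ℤ, (R : ℤ) < |n| → code z t n = code z' t' n := by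
  obtain ⟨c, d, hc, hd, hcd⟩ := exists_bitHeight_shift h
  have hcd : c = d := by omega
  subst hcd
  obtain ⟨R, hNR, hR⟩ := exists_ε_eq (z' := z') (N := N) (c := c) hz fun k hk => by
    rcases lt_abs.1 hk with hk | hk
    · exact hc k hk
    · exact hd k (by omega)
  refine ⟨R, fun n hn => ?_⟩
  have hNn : (N : ℤ) < |n| := by omega
  obtain ⟨h1, h2⟩ := hR n hn
  rcases fin_two_cases (z n) with h0 | h0
  · rw [code_of_zero t h0, code_of_zero t' ((h n hNn).symm.trans h0), h1, ht _ h2]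
  · rw [code_of_one t h0, code_of_one t' ((h n hNn).symm.trans h0), ht _ hNn]

section

/-! ## Exchangeable sequences of bits -/

/-- The real-valued sign of the bit at `i`. -/
def rsgn (i : ℤ) (z : ℤ → Fin 2) : ℝ := (sgn (z i) : ℝ)

theorem measurable_rsgn (i : ℤ) : Measurable (rsgn i) :=
  (measurable_of_countable fun b : Fin 2 => (sgn b : ℝ)).comp (measurable_pi_apply i)

theorem rsgn_eq (i : ℤ) (z : ℤ → Fin 2) : rsgn i z = 1 ∨ rsgn i z = -1 := by
  unfold rsgn
  rcases fin_two_cases (z i) with h | h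
  · right; rw [h, sgn_zero]; norm_num
  · left; rw [h, sgn_one]; norm_num

theorem abs_rsgn (i : ℤ) (z : ℤ → Fin 2) : |rsgn i z| = 1 := by
  rcases rsgn_eq i z with h | h <;> rw [h] <;> norm_num

theorem rsgn_mul_self (i : ℤ) (z : ℤ → Fin 2) : rsgn i z * rsgn i z = 1 := by
  rcases rsgn_eq i z with h | h <;> rw [h] <;> norm_num

/-- Invariance of a law on bit sequences under exchanging two coordinates. -/
def Exchangeable (ν : Measure (ℤ → Fin 2)) : Prop :=
  ∀ i j : ℤ, MeasurePreserving (fun z : ℤ → Fin 2 => z ∘ Equiv.swap i j) ν ν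

theorem Exchangeable.integral_comp {ν : Measure (ℤ → Fin 2)} (h : Exchangeable ν) (i j : ℤ)
    {f : (ℤ → Fin 2) → ℝ} (hf : Measurable f) :
    ∫ z, f (z ∘ Equiv.swap i j) ∂ν = ∫ z, f z ∂ν := by
  conv_rhs => rw [← (h i j).map_eq]
  rw [integral_map (h i j).measurable.aemeasurable hf.aestronglyMeasurable]

theorem integrable_of_abs_le {Ω : Type*} [MeasurableSpace Ω] {ν : Measure Ω} [IsFiniteMeasure ν]
    {f : Ω → ℝ} (hf : Measurable f) {C : ℝ} (hC : ∀ z, |f z| ≤ C) : Integrable f ν :=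
  Integrable.of_bound hf.aestronglyMeasurable C (Eventually.of_forall hC)

variable {ν : Measure (ℤ → Fin 2)} [IsProbabilityMeasure ν]

theorem integrable_rsgn_mul (i j : ℤ) : Integrable (fun z => rsgn i z * rsgn j z) ν :=
  integrable_of_abs_le ((measurable_rsgn i).mul (measurable_rsgn j)) (C := 1) fun z => by
    rw [abs_mul, abs_rsgn, abs_rsgn, one_mul]

theorem abs_integral_le_one {f : (ℤ → Fin 2) → ℝ} (hf : ∀ z, |f z| ≤ 1) : |∫ z, f z ∂ν| ≤ 1 := by
  have := norm_integral_le_of_norm_le_const (μ := ν) (f := f) (C := 1) (Eventually.of_forall hf)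
  simpa using this

/-! ### Second moments of exchangeable signs -/

theorem Exchangeable.exists_correlation (h : Exchangeable ν) :
    ∃ c : ℝ, |c| ≤ 1 ∧ ∀ i j, ∫ z, rsgn i z * rsgn j z ∂ν = if i = j then 1 else c := by
  have h1 : ∀ i j k, j ≠ i → k ≠ i →
      ∫ z, rsgn i z * rsgn j z ∂ν = ∫ z, rsgn i z * rsgn k z ∂ν := by
    intro i j k hj hk
    rw [← h.integral_comp j k (f := fun z => rsgn i z * rsgn j z)
      ((measurable_rsgn i).mul (measurable_rsgn j))]
    refine integral_congr_ae (Eventually.of_forall fun z => ?_)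
    simp [rsgn, Equiv.swap_apply_of_ne_of_ne hj.symm hk.symm]
  have h2 : ∀ i j, ∫ z, rsgn i z * rsgn j z ∂ν = ∫ z, rsgn j z * rsgn i z ∂ν := by
    intro i j
    simp only [mul_comm]
  refine ⟨∫ z, rsgn 0 z * rsgn 1 z ∂ν, ?_, fun i j => ?_⟩
  · exact abs_integral_le_one fun z => by rw [abs_mul, abs_rsgn, abs_rsgn, one_mul]
  · split_ifs with hij
    · subst hij
      simp [rsgn_mul_self]
    · by_cases hi : i = 1
      · subst hi
        rw [h1 1 j 0 (Ne.symm hij) (by norm_num), h2]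
      · rw [h1 i j 1 (Ne.symm hij) (Ne.symm hi), h2, h1 1 i 0 hi (by norm_num), h2]

/-- All off-diagonal correlations equal one constant `c`, so the integral is `c (∑ w)² + (1 - c) ∑
w²`; the first term vanishes and `1 - c ≤ 2`. -/
theorem Exchangeable.integral_sq_le (h : Exchangeable ν) (K : Finset ℤ) (w : ℤ → ℝ)
    (hw : ∑ i ∈ K, w i = 0) :
    ∫ z, (∑ i ∈ K, w i * rsgn i z) ^ 2 ∂ν ≤ 2 * ∑ i ∈ K, w i ^ 2 := by
  obtain ⟨c, hc, hcij⟩ := h.exists_correlation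
  have e : ∀ z, (∑ i ∈ K, w i * rsgn i z) ^ 2 =
      ∑ i ∈ K, ∑ j ∈ K, (w i * w j) * (rsgn i z * rsgn j z) := by
    intro z
    rw [sq, Finset.sum_mul_sum]
    exact Finset.sum_congr rfl fun i _ => Finset.sum_congr rfl fun j _ => by ring
  simp only [e]
  rw [integral_finsetSum _ fun i _ => integrable_finsetSum _ fun j _ =>
    (integrable_rsgn_mul i j).const_mul _]
  have e2 : ∀ i ∈ K, ∫ z, ∑ j ∈ K, (w i * w j) * (rsgn i z * rsgn j z) ∂ν =
      c * (w i * ∑ j ∈ K, w j) + (1 - c) * w i ^ 2 := by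
    intro i hi
    rw [integral_finsetSum _ fun j _ => (integrable_rsgn_mul i j).const_mul _]
    have e3 : ∀ j ∈ K, ∫ z, (w i * w j) * (rsgn i z * rsgn j z) ∂ν =
        c * (w i * w j) + if i = j then (1 - c) * w i ^ 2 else 0 := by
      intro j _
      rw [integral_const_mul, hcij]
      split_ifs with hij
      · subst hij; ring
      · ring
    rw [Finset.sum_congr rfl e3, Finset.sum_add_distrib, ← Finset.mul_sum, ← Finset.mul_sum]
    simp [hi]
  rw [Finset.sum_congr rfl e2, hw]
  simp only [mul_zero, zero_add]
  rw [← Finset.mul_sum]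
  have := Finset.sum_nonneg (s := K) (f := fun i => w i ^ 2) fun i _ => sq_nonneg _
  exact mul_le_mul_of_nonneg_right (by linarith [neg_le_of_abs_le hc]) this

/-- The average of the signs over a finite set of coordinates. -/
def avg (I : Finset ℤ) (z : ℤ → Fin 2) : ℝ := (∑ i ∈ I, rsgn i z) / I.card

theorem measurable_avg (I : Finset ℤ) : Measurable (avg I) :=
  (Finset.measurable_fun_sum I fun i _ => measurable_rsgn i).div_const _

theorem abs_sum_rsgn_le (I : Finset ℤ) (z : ℤ → Fin 2) : |∑ i ∈ I, rsgn i z| ≤ I.card := by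
  refine (Finset.abs_sum_le_sum_abs _ _).trans ?_
  simp [abs_rsgn]

theorem abs_avg_le (I : Finset ℤ) (z : ℤ → Fin 2) : |avg I z| ≤ 1 := by
  rw [avg, abs_div, Nat.abs_cast]
  exact div_le_one_of_le₀ (abs_sum_rsgn_le I z) (Nat.cast_nonneg _)

theorem Exchangeable.integral_avg_sub_sq_le (h : Exchangeable ν) {I J : Finset ℤ}
    (hI : I.Nonempty) (hJ : J.Nonempty) :
    ∫ z, (avg I z - avg J z) ^ 2 ∂ν ≤ 4 * (1 / I.card + 1 / J.card) := by
  have hI0 : (I.card : ℝ) ≠ 0 := by exact_mod_cast hI.card_pos.ne'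
  have hJ0 : (J.card : ℝ) ≠ 0 := by exact_mod_cast hJ.card_pos.ne'
  have hsum : ∀ (A : Finset ℤ), A ⊆ I ∪ J → ∀ f : ℤ → ℝ,
      ∑ i ∈ I ∪ J, (if i ∈ A then f i else 0) = ∑ i ∈ A, f i := by
    intro A hA f
    rw [Finset.sum_ite_mem, Finset.inter_eq_right.2 hA]
  have hIu := hsum I Finset.subset_union_left
  have hJu := hsum J Finset.subset_union_right
  -- These weights have sum zero. On the overlap of `I` and `J` the square is bounded by `(a - b)² ≤
  -- 2a² + 2b²`.
  set w : ℤ → ℝ := fun i =>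
    (if i ∈ I then (1 : ℝ) / I.card else 0) - if i ∈ J then (1 : ℝ) / J.card else 0 with hw
  have e : ∀ z, avg I z - avg J z = ∑ i ∈ I ∪ J, w i * rsgn i z := by
    intro z
    simp only [hw, sub_mul, ite_mul, zero_mul, Finset.sum_sub_distrib]
    rw [hIu, hJu, ← Finset.mul_sum, ← Finset.mul_sum, avg, avg]
    ring
  simp only [e]
  refine (h.integral_sq_le (I ∪ J) w ?_).trans ?_
  · simp only [hw, Finset.sum_sub_distrib]
    rw [hIu, hJu]
    simp [hI0, hJ0]
  · have : ∑ i ∈ I ∪ J, w i ^ 2 ≤ ∑ i ∈ I ∪ J, ((if i ∈ I then 2 * ((1 : ℝ) / I.card) ^ 2 else 0) +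
        if i ∈ J then 2 * ((1 : ℝ) / J.card) ^ 2 else 0) := by
      refine Finset.sum_le_sum fun i _ => ?_
      simp only [hw]
      split_ifs
      · nlinarith [sq_nonneg ((1 : ℝ) / I.card + 1 / J.card)]
      · nlinarith [sq_nonneg ((1 : ℝ) / I.card)]
      · nlinarith [sq_nonneg ((1 : ℝ) / J.card)]
      · simp
    rw [Finset.sum_add_distrib, hIu, hJu] at this
    simp only [Finset.sum_const, nsmul_eq_mul] at this
    have e1 : (I.card : ℝ) * (2 * (1 / I.card) ^ 2) = 2 * (1 / I.card) := by field_simp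
    have e2 : (J.card : ℝ) * (2 * (1 / J.card) ^ 2) = 2 * (1 / J.card) := by field_simp
    rw [e1, e2] at this
    linarith

theorem integrable_avg_sub (I J : Finset ℤ) : Integrable (fun z => avg I z - avg J z) ν :=
  integrable_of_abs_le ((measurable_avg I).sub (measurable_avg J)) (C := 2) fun z =>
    (abs_sub _ _).trans (by linarith [abs_avg_le I z, abs_avg_le J z])

theorem integrable_avg_sub_sq (I J : Finset ℤ) :
    Integrable (fun z => (avg I z - avg J z) ^ 2) ν := by
  refine integrable_of_abs_le (((measurable_avg I).sub (measurable_avg J)).pow_const 2) (C := 4)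
    fun z => ?_
  have h : |avg I z - avg J z| ≤ 2 :=
    (abs_sub _ _).trans (by linarith [abs_avg_le I z, abs_avg_le J z])
  rw [abs_pow]
  nlinarith [abs_nonneg (avg I z - avg J z)]

theorem abs_le_weighted_sq (a : ℝ) {q : ℝ} (hq : 0 < q) :
    |a| ≤ q ^ 2 / 2 * a ^ 2 + 1 / 2 * (1 / q ^ 2) := by
  have hsq := sq_nonneg (q * |a| - 1 / q)
  have e : q * |a| * (1 / q) = |a| := by field_simp
  rw [sub_sq, mul_pow, sq_abs, div_pow, one_pow] at hsq
  linarith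

/-- Sizes of order `k⁴` make the mean square `O(k⁻⁴)`; the weighted bound `abs_le_weighted_sq` turns
this into an `L¹` bound `O(k⁻²)`, which is summable. -/
theorem Exchangeable.integral_abs_avg_sub_le (h : Exchangeable ν) {I J : Finset ℤ} {k : ℕ}
    (hI : (k + 1) ^ 4 ≤ I.card) (hJ : (k + 1) ^ 4 ≤ J.card) :
    ∫ z, |avg I z - avg J z| ∂ν ≤ 5 * (1 / ((k : ℝ) + 1) ^ 2) := by
  have hq : 0 < (k : ℝ) + 1 := by positivity
  have hcard : ∀ A : Finset ℤ, (k + 1) ^ 4 ≤ A.card → (1 : ℝ) / A.card ≤ 1 / ((k : ℝ) + 1) ^ 4 :=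
    fun A hA => one_div_le_one_div_of_le (by positivity) (by exact_mod_cast hA)
  have hne : ∀ A : Finset ℤ, (k + 1) ^ 4 ≤ A.card → A.Nonempty := fun A hA =>
    Finset.card_pos.1 (lt_of_lt_of_le (by positivity) hA)
  have h2 := h.integral_avg_sub_sq_le (hne _ hI) (hne _ hJ)
  have h3 := hcard _ hI
  have h4 := hcard _ hJ
  generalize (k : ℝ) + 1 = q at *
  have h5 : ∫ z, (avg I z - avg J z) ^ 2 ∂ν ≤ 8 * (1 / q ^ 4) := by linarith
  have h6 : ∫ z, |avg I z - avg J z| ∂ν ≤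
      ∫ z, (q ^ 2 / 2 * (avg I z - avg J z) ^ 2 + 1 / 2 * (1 / q ^ 2)) ∂ν :=
    integral_mono (integrable_avg_sub I J).abs
      (((integrable_avg_sub_sq I J).const_mul _).add (integrable_const _))
      fun z => abs_le_weighted_sq _ hq
  rw [integral_add ((integrable_avg_sub_sq I J).const_mul _) (integrable_const _),
    integral_const_mul, integral_const, probReal_univ, one_smul] at h6
  have h7 := mul_le_mul_of_nonneg_left h5 (show 0 ≤ q ^ 2 / 2 by positivity)
  have h8 : q ^ 2 / 2 * (8 * (1 / q ^ 4)) = 4 * (1 / q ^ 2) := by field_simp; ring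
  have h9 : 0 < 1 / q ^ 2 := by positivity
  linarith

/-- Averages over sets of size at least `(k+1)⁴` have almost surely summable differences. -/
theorem Exchangeable.ae_summable (h : Exchangeable ν) {I J : ℕ → Finset ℤ}
    (hI : ∀ k, (k + 1) ^ 4 ≤ (I k).card) (hJ : ∀ k, (k + 1) ^ 4 ≤ (J k).card) :
    ∀ᵐ z ∂ν, Summable fun k => |avg (I k) z - avg (J k) z| := by
  have hsm : Summable fun k : ℕ => 5 * (1 / ((k : ℝ) + 1) ^ 2) := by
    refine Summable.mul_left _ ?_
    have := (summable_nat_add_iff 1).2 (Real.summable_one_div_nat_pow.2 (one_lt_two))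
    simpa using this
  have := Summable.of_nonneg_of_le (fun k => integral_nonneg fun z => abs_nonneg _)
    (fun k => h.integral_abs_avg_sub_le (hI k) (hJ k)) hsm
  have hint : ∀ k, Integrable (fun z => avg (I k) z - avg (J k) z) ν := fun k =>
    integrable_avg_sub _ _
  have hne : ∑' k, eLpNorm (fun z => avg (I k) z - avg (J k) z) 1 ν ≠ ⊤ := by
    have e : ∀ k, eLpNorm (fun z => avg (I k) z - avg (J k) z) 1 ν =
        ENNReal.ofReal (∫ z, |avg (I k) z - avg (J k) z| ∂ν) := by
      intro k
      rw [eLpNorm_one_eq_lintegral_enorm, ← ofReal_integral_norm_eq_lintegral_enorm (hint k)]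
      rfl
    rw [tsum_congr e]
    exact this.tsum_ofReal_ne_top
  have h1 := summable_norm_of_tsum_eLpNorm_ne_top (p := 1) le_rfl
    (f := fun k z => avg (I k) z - avg (J k) z) (fun k => (hint k).aestronglyMeasurable) hne
  filter_upwards [h1] with z hz
  exact hz

/-! ### Drift along fourth powers, and its absence -/

theorem abs_sub_le_of_lipschitz {h : ℕ → ℝ} (hh : ∀ n, |h (n + 1) - h n| ≤ 1) (k n : ℕ) :
    |h (k + n) - h k| ≤ n := by
  induction n with
  | zero => simp
  | succ n ih =>
    have := abs_sub_le (h (k + (n + 1))) (h (k + n)) (h k)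
    have h1 := hh (k + n)
    rw [add_assoc] at h1
    push_cast
    linarith

/-- At `q ^ 4` the value exceeds `(θ / 2) q ^ 4`, while the gap to the next fourth power is at most
`15 q ^ 3`. A function with steps at most one cannot become negative in between. -/
theorem eventually_nonneg_of_tendsto {h : ℕ → ℝ} (hh : ∀ n, |h (n + 1) - h n| ≤ 1) {θ : ℝ}
    (hθ : 0 < θ)
    (ht : Tendsto (fun k : ℕ => h ((k + 1) ^ 4) / ((k + 1) ^ 4 : ℕ)) atTop (nhds θ)) :
    ∃ K, ∀ n, K ≤ n → 0 ≤ h n := by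
  obtain ⟨K₁, hK₁⟩ := eventually_atTop.1 (ht.eventually (lt_mem_nhds (half_lt_self hθ)))
  -- Beyond `30 / θ` one has `15 q ^ 3 ≤ (θ / 2) q ^ 4`.
  obtain ⟨K₂, hK₂⟩ := exists_nat_gt (30 / θ)
  refine ⟨(max K₁ K₂ + 1) ^ 4, fun n hn => ?_⟩
  obtain ⟨q, hq⟩ : ∃ q, q = Nat.findGreatest (fun q => q ^ 4 ≤ n) n := ⟨_, rfl⟩
  have hle : max K₁ K₂ + 1 ≤ q := by
    rw [hq]
    exact Nat.le_findGreatest ((Nat.le_self_pow (by norm_num) _).trans hn) hn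
  have hqn : q ^ 4 ≤ n := by
    rw [hq]
    exact Nat.findGreatest_spec (P := fun q => q ^ 4 ≤ n) (m := 0) (Nat.zero_le _) (by simp)
  have hqn' : n < (q + 1) ^ 4 := by
    by_contra hlt
    rw [not_lt] at hlt
    have := Nat.le_findGreatest (P := fun q => q ^ 4 ≤ n)
      ((Nat.le_self_pow (by norm_num) _).trans hlt) hlt
    omega
  obtain ⟨p, rfl⟩ : ∃ p, q = p + 1 := ⟨q - 1, by omega⟩
  have h1 := hK₁ p (by have := le_max_left K₁ K₂; omega)
  have h2 : (30 / θ) < p + 1 := by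
    have : (K₂ : ℝ) ≤ p := by exact_mod_cast (by have := le_max_right K₁ K₂; omega)
    linarith
  rw [div_lt_iff₀ hθ] at h2
  rw [lt_div_iff₀ (by positivity)] at h1
  obtain ⟨d, rfl⟩ : ∃ d, n = (p + 1) ^ 4 + d := ⟨n - (p + 1) ^ 4, by omega⟩
  have h3 := (abs_le.1 (abs_sub_le_of_lipschitz hh ((p + 1) ^ 4) d)).1
  have hd : (d : ℝ) ≤ 15 * ((p : ℝ) + 1) ^ 3 := by
    have h4 : ((p + 1) ^ 4 + d : ℝ) < (p + 1 + 1) ^ 4 := by exact_mod_cast hqn'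
    have hp : (0 : ℝ) ≤ p := Nat.cast_nonneg p
    nlinarith [pow_nonneg hp 2, pow_nonneg hp 3]
  have h5 : 15 * ((p : ℝ) + 1) ^ 3 ≤ θ / 2 * ((p : ℝ) + 1) ^ 4 := by
    have : 0 ≤ ((p : ℝ) + 1) ^ 3 := by positivity
    nlinarith
  push_cast at h1
  linarith

theorem cast_bitHeight_eq (z : ℤ → Fin 2) (n : ℕ) :
    (bitHeight z n : ℝ) = ∑ i ∈ Finset.Ico (0 : ℤ) n, rsgn i z := by
  have := bitHeight_sub z (a := 0) (b := n) (by omega)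
  rw [bitHeight_zero, sub_zero] at this
  rw [this]
  push_cast
  rfl

theorem cast_bitHeight_neg_eq (z : ℤ → Fin 2) (n : ℕ) :
    (bitHeight z (-n) : ℝ) = -∑ i ∈ Finset.Ico (-n : ℤ) 0, rsgn i z := by
  have := bitHeight_sub z (a := -n) (b := 0) (by omega)
  rw [bitHeight_zero, zero_sub, neg_eq_iff_eq_neg] at this
  rw [this]
  push_cast
  rfl

theorem abs_cast_bitHeight_succ_sub (z : ℤ → Fin 2) (i : ℤ) :
    |(bitHeight z (i + 1) : ℝ) - bitHeight z i| ≤ 1 := by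
  rw [bitHeight_succ]
  push_cast
  rw [add_sub_cancel_left]
  exact (abs_rsgn i z).le

/-- Since `H_{-n}` is minus the sum of the signs on `[-n, 0)`, a negative mean makes the heights
eventually nonnegative on the left, and a positive mean does so on the right. -/
theorem limit_eq_zero {z : ℤ → Fin 2} (hz : Unbounded (bitHeight z)) {θ : ℝ}
    (hr : Tendsto (fun k : ℕ => avg (Finset.Ico (0 : ℤ) ((k + 1) ^ 4 : ℕ)) z) atTop (nhds θ))
    (hl : Tendsto (fun k : ℕ => avg (Finset.Ico (-((k + 1) ^ 4 : ℕ) : ℤ) 0) z) atTop (nhds θ)) :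
    θ = 0 := by
  rcases lt_trichotomy θ 0 with h | h | h
  · exfalso
    obtain ⟨K, hK⟩ := eventually_nonneg_of_tendsto (h := fun n : ℕ => (bitHeight z (-n) : ℝ))
      (fun n => by
        have := abs_cast_bitHeight_succ_sub z (-((n + 1 : ℕ) : ℤ))
        rw [abs_sub_comm] at this
        convert this using 4
        push_cast
        ring_nf) (neg_pos.2 h) (by
        refine hl.neg.congr fun k => ?_
        rw [cast_bitHeight_neg_eq, avg, Int.card_Ico, neg_div, zero_sub, neg_neg,
          Int.toNat_natCast])
    obtain ⟨i, hi, hi'⟩ := hz.2 (-1) (-K)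
    have := hK i.natAbs (by omega)
    have e : -(i.natAbs : ℤ) = i := by omega
    simp only [e] at this
    have h0 : (0 : ℤ) ≤ bitHeight z i := by exact_mod_cast this
    omega
  · exact h
  · exfalso
    obtain ⟨K, hK⟩ := eventually_nonneg_of_tendsto (h := fun n : ℕ => (bitHeight z n : ℝ))
      (fun n => by
        have := abs_cast_bitHeight_succ_sub z n
        exact_mod_cast this) h (by
        refine hr.congr fun k => ?_
        rw [cast_bitHeight_eq, avg, Int.card_Ico, sub_zero, Int.toNat_natCast])
    obtain ⟨i, hi, hi'⟩ := hz.1 (-1) K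
    have := hK i.natAbs (by omega)
    have e : (i.natAbs : ℤ) = i := by omega
    simp only [e] at this
    have h0 : (0 : ℤ) ≤ bitHeight z i := by exact_mod_cast this
    omega

/-- Exchangeable bits whose heights are unbounded below in both directions have no drift. -/
theorem Exchangeable.ae_tendsto_avg (h : Exchangeable ν)
    (hS : ∀ᵐ z ∂ν, Unbounded (bitHeight z)) :
    ∀ᵐ z ∂ν, Tendsto (fun k : ℕ => avg (Finset.Ico (0 : ℤ) ((k + 1) ^ 4 : ℕ)) z) atTop (nhds 0) := by
  -- Comparing consecutive blocks gives convergence; comparing right blocks with left blocks of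
  -- equal size gives the same limit on both sides.
  have h1 := h.ae_summable (I := fun k => Finset.Ico (0 : ℤ) ((k + 1) ^ 4 : ℕ))
    (J := fun k => Finset.Ico (0 : ℤ) ((k + 1 + 1) ^ 4 : ℕ)) (fun k => by
      rw [Int.card_Ico, sub_zero, Int.toNat_natCast])
    (fun k => by
      rw [Int.card_Ico, sub_zero, Int.toNat_natCast]
      exact Nat.pow_le_pow_left (by omega) 4)
  have h2 := h.ae_summable (I := fun k => Finset.Ico (0 : ℤ) ((k + 1) ^ 4 : ℕ))
    (J := fun k => Finset.Ico (-((k + 1) ^ 4 : ℕ) : ℤ) 0) (fun k => by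
      rw [Int.card_Ico, sub_zero, Int.toNat_natCast])
    (fun k => by rw [Int.card_Ico, zero_sub, neg_neg, Int.toNat_natCast])
  filter_upwards [h1, h2, hS] with z h1 h2 hz
  obtain ⟨θ, hθ⟩ := cauchySeq_tendsto_of_complete (cauchySeq_of_summable_dist
    (f := fun k : ℕ => avg (Finset.Ico (0 : ℤ) ((k + 1) ^ 4 : ℕ)) z) h1)
  have hd := (tendsto_zero_iff_abs_tendsto_zero _).2 h2.tendsto_atTop_zero
  have hl := hθ.sub hd
  simp only [sub_sub_cancel, sub_zero] at hl
  have := limit_eq_zero hz hθ hl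
  rwa [this] at hθ

/-- Swapping `i` and `j` shows that the integral is the same for every index off `s`. Up to an error
`O(|s| / |A|)` it is thus the integral of `f` times the average over a long block `A`, which tends
to zero by dominated convergence. -/
theorem Exchangeable.integral_mul_rsgn_eq_zero (h : Exchangeable ν)
    (hS : ∀ᵐ z ∂ν, Unbounded (bitHeight z)) {s : Finset ℤ} {f : (ℤ → Fin 2) → ℝ}
    (hf : Measurable f) (hf1 : ∀ z, |f z| ≤ 1) (hfs : ∀ z z', (∀ i ∈ s, z i = z' i) → f z = f z')
    {i : ℤ} (hi : i ∉ s) : ∫ z, f z * rsgn i z ∂ν = 0 := by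
  set e := ∫ z, f z * rsgn i z ∂ν with he
  have hint : ∀ j, Integrable (fun z => f z * rsgn j z) ν := fun j =>
    integrable_of_abs_le (hf.mul (measurable_rsgn j)) (C := 1) fun z => by
      rw [abs_mul, abs_rsgn, mul_one]; exact hf1 z
  have hbd : ∀ j, |∫ z, f z * rsgn j z ∂ν| ≤ 1 := fun j =>
    abs_integral_le_one fun z => by rw [abs_mul, abs_rsgn, mul_one]; exact hf1 z
  have hj : ∀ j, j ∉ s → ∫ z, f z * rsgn j z ∂ν = e := by
    intro j hj
    rw [he, ← h.integral_comp i j (f := fun z => f z * rsgn i z) (hf.mul (measurable_rsgn i))]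
    refine integral_congr_ae (Eventually.of_forall fun z => ?_)
    simp only [rsgn, Function.comp_apply, Equiv.swap_apply_left]
    rw [hfs z (z ∘ Equiv.swap i j)]
    intro k hk
    rw [Function.comp_apply, Equiv.swap_apply_of_ne_of_ne (ne_of_mem_of_not_mem hk hi)
      (ne_of_mem_of_not_mem hk hj)]
  have hmean : ∀ k : ℕ, |e| ≤ |∫ z, f z * avg (Finset.Ico (0 : ℤ) ((k + 1) ^ 4 : ℕ)) z ∂ν| +
      2 * s.card * (1 / ((k : ℝ) + 1)) := by
    intro k
    set A := Finset.Ico (0 : ℤ) ((k + 1) ^ 4 : ℕ) with hA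
    have hcard : A.card = (k + 1) ^ 4 := by
      rw [hA, Int.card_Ico, sub_zero, Int.toNat_natCast]
    have e1 : ∫ z, f z * avg A z ∂ν = (∑ j ∈ A, ∫ z, f z * rsgn j z ∂ν) / A.card := by
      rw [← integral_finsetSum _ fun j _ => hint j, ← integral_div]
      refine integral_congr_ae (Eventually.of_forall fun z => ?_)
      simp only [avg, ← Finset.mul_sum]
      ring
    have e2 : |∑ j ∈ A, (e - ∫ z, f z * rsgn j z ∂ν)| ≤ 2 * s.card := by
      refine (Finset.abs_sum_le_sum_abs _ _).trans ?_
      calc ∑ j ∈ A, |e - ∫ z, f z * rsgn j z ∂ν| ≤ ∑ j ∈ A, if j ∈ s then (2 : ℝ) else 0 := by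
            refine Finset.sum_le_sum fun j _ => ?_
            split_ifs with hjs
            · exact (abs_sub _ _).trans (by linarith [hbd i, hbd j])
            · rw [hj j hjs, sub_self, abs_zero]
        _ = 2 * (A ∩ s).card := by
            rw [Finset.sum_ite_mem, Finset.sum_const, nsmul_eq_mul, mul_comm]
        _ ≤ 2 * s.card := by
            gcongr
            exact Finset.inter_subset_right
    rw [Finset.sum_sub_distrib, Finset.sum_const, nsmul_eq_mul] at e2
    have hpos : (0 : ℝ) < A.card := by rw [hcard]; positivity
    have e3 : e = (∫ z, f z * avg A z ∂ν) +
        (A.card * e - ∑ j ∈ A, ∫ z, f z * rsgn j z ∂ν) / A.card := by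
      rw [e1]; field_simp; ring
    have e4 : |(A.card * e - ∑ j ∈ A, ∫ z, f z * rsgn j z ∂ν) / A.card| ≤
        2 * s.card * (1 / ((k : ℝ) + 1)) := by
      rw [abs_div, Nat.abs_cast, div_eq_mul_one_div]
      refine mul_le_mul e2 (one_div_le_one_div_of_le (by positivity) ?_)
        (one_div_nonneg.2 (Nat.cast_nonneg _)) (mul_nonneg two_pos.le (Nat.cast_nonneg _))
      rw [hcard]
      exact_mod_cast Nat.le_self_pow (by norm_num) (k + 1)
    calc |e| ≤ |∫ z, f z * avg A z ∂ν| +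
          |(A.card * e - ∑ j ∈ A, ∫ z, f z * rsgn j z ∂ν) / A.card| := by
            conv_lhs => rw [e3]
            exact abs_add_le _ _
      _ ≤ _ := by linarith
  have hlim : Tendsto (fun k : ℕ => ∫ z, f z * avg (Finset.Ico (0 : ℤ) ((k + 1) ^ 4 : ℕ)) z ∂ν)
      atTop (nhds (∫ z, (0 : ℝ) ∂ν)) := by
    refine tendsto_integral_of_dominated_convergence (fun _ => 1)
      (fun k => (hf.mul (measurable_avg _)).aestronglyMeasurable) (integrable_const _)
      (fun k => Eventually.of_forall fun z => ?_) ?_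
    · rw [Real.norm_eq_abs, abs_mul]
      exact mul_le_one₀ (hf1 z) (abs_nonneg _) (abs_avg_le _ z)
    · filter_upwards [h.ae_tendsto_avg hS] with z hz
      simpa using hz.const_mul (f z)
  rw [integral_zero] at hlim
  have hlim2 : Tendsto (fun k : ℕ => |∫ z, f z * avg (Finset.Ico (0 : ℤ) ((k + 1) ^ 4 : ℕ)) z ∂ν| +
      2 * s.card * (1 / ((k : ℝ) + 1))) atTop (nhds 0) := by
    have := hlim.abs.add ((tendsto_one_div_add_atTop_nhds_zero_nat (𝕜 := ℝ)).const_mul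
      (2 * (s.card : ℝ)))
    simpa using this
  exact abs_eq_zero.1 (le_antisymm (ge_of_tendsto' hlim2 hmean) (abs_nonneg _))

theorem uniformOn_univ_fin_two (t : Set (Fin 2)) :
    (uniformOn (Set.univ : Set (Fin 2))).real t =
      (t.indicator (fun _ => (1 : ℝ)) 0 + t.indicator (fun _ => (1 : ℝ)) 1) / 2 := by
  rw [measureReal_def, uniformOn_univ, Measure.count_apply (by exact t.toFinite.measurableSet)]
  classical
  have ht : t = (if (0 : Fin 2) ∈ t then {0} else ∅) ∪ (if (1 : Fin 2) ∈ t then {1} else ∅) := by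
    ext b
    rcases fin_two_cases b with rfl | rfl <;>
      by_cases h0 : (0 : Fin 2) ∈ t <;> by_cases h1 : (1 : Fin 2) ∈ t <;> simp [h0, h1]
  by_cases h0 : (0 : Fin 2) ∈ t <;> by_cases h1 : (1 : Fin 2) ∈ t
  all_goals
    simp only [h0, h1, if_true, if_false] at ht
    simp only [Set.indicator, h0, h1, if_true, if_false]
    rw [ht]
  · rw [Set.singleton_union, Set.encard_pair (by decide)]
    norm_num
  · simp
  · simp
  · simp

/-- Exchangeable bits whose heights are unbounded below in both directions are fair coins. -/
theorem Exchangeable.eq_μ₁ (h : Exchangeable ν) (hS : ∀ᵐ z ∂ν, Unbounded (bitHeight z)) :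
    ν = μ₁ := by
  refine Measure.eq_infinitePi _ fun s t _ => ?_
  have ht : ∀ i, MeasurableSet (t i) := fun i => (t i).toFinite.measurableSet
  suffices H : ν.real (Set.pi s t) = ∏ i ∈ s, (uniformOn (Set.univ : Set (Fin 2))).real (t i) by
    rw [← ofReal_measureReal, H, ENNReal.ofReal_prod_of_nonneg fun i _ => measureReal_nonneg]
    exact Finset.prod_congr rfl fun i _ => ofReal_measureReal
  have hm : ∀ s : Finset ℤ, MeasurableSet (Set.pi (s : Set ℤ) t) := fun s =>
    MeasurableSet.pi s.countable_toSet fun i _ => ht i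
  induction s using Finset.induction_on with
  | empty => simp
  | insert i s hi ih =>
    rw [Finset.prod_insert hi, ← ih]
    set f : (ℤ → Fin 2) → ℝ := (Set.pi (s : Set ℤ) t).indicator fun _ => 1 with hf
    have hfm : Measurable f := measurable_const.indicator (hm s)
    have hf1 : ∀ z, |f z| ≤ 1 := fun z => by
      by_cases hz : z ∈ Set.pi (s : Set ℤ) t <;> simp [hf, hz]
    have hfs : ∀ z z', (∀ i ∈ s, z i = z' i) → f z = f z' := by
      intro z z' hzz
      have : z ∈ Set.pi (s : Set ℤ) t ↔ z' ∈ Set.pi (s : Set ℤ) t :=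
        forall₂_congr fun i hi => by rw [hzz i hi]
      by_cases hz : z ∈ Set.pi (s : Set ℤ) t
      · simp [hf, hz, this.1 hz]
      · simp [hf, hz, mt this.2 hz]
    have h0 := h.integral_mul_rsgn_eq_zero hS hfm hf1 hfs hi
    set a := (t i).indicator (fun _ => (1 : ℝ)) 0 with ha
    set b := (t i).indicator (fun _ => (1 : ℝ)) 1 with hb
    -- A function of one bit is affine in its sign, and the sign term integrates to zero by `h0`.
    have e : ∀ z, (Set.pi ((insert i s : Finset ℤ) : Set ℤ) t).indicator (fun _ => (1 : ℝ)) z =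
        (a + b) / 2 * f z + (b - a) / 2 * (f z * rsgn i z) := by
      intro z
      have e1 : (Set.pi ((insert i s : Finset ℤ) : Set ℤ) t).indicator (fun _ => (1 : ℝ)) z =
          f z * (t i).indicator (fun _ => (1 : ℝ)) (z i) := by
        rw [hf, Finset.coe_insert, Set.insert_pi]
        by_cases hz : z ∈ Set.pi (s : Set ℤ) t <;> by_cases hzi : z i ∈ t i <;> simp [hz, hzi]
      rw [e1]
      rcases fin_two_cases (z i) with hzi | hzi
      · rw [rsgn, hzi, sgn_zero, ← ha]; push_cast; ring
      · rw [rsgn, hzi, sgn_one, ← hb]; push_cast; ring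
    have hfi : Integrable f ν := integrable_of_abs_le hfm hf1
    have hfi2 : Integrable (fun z => f z * rsgn i z) ν :=
      integrable_of_abs_le (hfm.mul (measurable_rsgn i)) (C := 1) fun z => by
        rw [abs_mul, abs_rsgn, mul_one]; exact hf1 z
    have e2 := integral_indicator_one (μ := ν) (hm (insert i s))
    have e3 := integral_indicator_one (μ := ν) (hm s)
    rw [← e2, ← e3, uniformOn_univ_fin_two, ← ha, ← hb]
    change ∫ z, (Set.pi ((insert i s : Finset ℤ) : Set ℤ) t).indicator (fun _ => (1 : ℝ)) z ∂ν =
      (a + b) / 2 * ∫ z, f z ∂ν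
    simp only [e]
    rw [integral_add (hfi.const_mul _) (hfi2.const_mul _), integral_const_mul, integral_const_mul,
      h0, mul_zero, add_zero]

end

/-! ## Symmetric random walks -/

/-- The events that do not change under any of the transformations `φ k` with `n ≤ k`. -/
def flipFiltration {Ω : Type*} [m₀ : MeasurableSpace Ω] (φ : ℕ → Ω → Ω) : Filtration ℕ m₀ where
  seq n :=
    { MeasurableSet' := fun A => MeasurableSet A ∧ ∀ k, n ≤ k → φ k ⁻¹' A = A
      measurableSet_empty := ⟨MeasurableSet.empty, fun _ _ => rfl⟩
      measurableSet_compl := fun A hA => ⟨hA.1.compl, fun k hk => by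
        rw [Set.preimage_compl, hA.2 k hk]⟩
      measurableSet_iUnion := fun A hA => ⟨MeasurableSet.iUnion fun i => (hA i).1, fun k hk => by
        rw [Set.preimage_iUnion]
        exact Set.iUnion_congr fun i => (hA i).2 k hk⟩ }
  mono' := fun _ _ hij _ hA => ⟨hA.1, fun k hk => hA.2 k (hij.trans hk)⟩
  le' := fun _ _ hA => hA.1

theorem measurableSet_flipFiltration {Ω : Type*} [m₀ : MeasurableSpace Ω] {φ : ℕ → Ω → Ω} {n : ℕ}
    {A : Set Ω} : MeasurableSet[flipFiltration φ n] A ↔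
      MeasurableSet A ∧ ∀ k, n ≤ k → φ k ⁻¹' A = A := Iff.rfl

/-- A walk with steps `±1` whose steps can be flipped independently is unbounded below. -/
theorem ae_not_bddBelow_of_flip {Ω : Type*} [MeasurableSpace Ω] {μ : Measure Ω}
    [IsProbabilityMeasure μ] {X : ℕ → Ω → ℝ} (hX : ∀ n, Measurable (X n))
    (habs : ∀ n ω, |X n ω| = 1) {φ : ℕ → Ω → Ω} (hφ : ∀ n, MeasurePreserving (φ n) μ μ)
    (hne : ∀ n k ω, k ≠ n → X k (φ n ω) = X k ω) (heq : ∀ n ω, X n (φ n ω) = -X n ω) :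
    ∀ᵐ ω ∂μ, ¬ BddBelow (Set.range fun n => ∑ k ∈ Finset.range n, X k ω) := by
  have hXi : ∀ n, Integrable (X n) μ := fun n =>
    integrable_of_abs_le (hX n) (C := 1) fun ω => (habs n ω).le
  have hmart : Martingale (fun n ω => ∑ k ∈ Finset.range n, X k ω) (flipFiltration φ) μ := by
    refine martingale_of_setIntegral_eq_succ (fun n => ?_)
      (fun n => integrable_finsetSum _ fun k _ => hXi k) fun n A hA => ?_
    · refine Measurable.stronglyMeasurable ?_
      intro s hs
      refine measurableSet_flipFiltration.2
        ⟨(Finset.measurable_fun_sum _ fun k _ => hX k) hs, fun j hj => ?_⟩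
      ext ω
      simp only [Set.mem_preimage]
      rw [Finset.sum_congr rfl fun k hk => hne j k ω (by
        have := Finset.mem_range.1 hk
        omega)]
    · obtain ⟨hA1, hA2⟩ := measurableSet_flipFiltration.1 hA
      -- `φ n` preserves `μ` and `A` and negates `X n`, so the integral equals its own negative.
      have h0 : ∫ ω in A, X n ω ∂μ = 0 := by
        have h1 : ∫ ω in A, X n ω ∂μ = ∫ ω, A.indicator (X n) (φ n ω) ∂μ := by
          rw [← integral_indicator hA1]
          conv_lhs => rw [← (hφ n).map_eq]
          rw [integral_map (hφ n).measurable.aemeasurable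
            ((hX n).indicator hA1).aestronglyMeasurable]
        have h2 : ∀ ω, A.indicator (X n) (φ n ω) = -A.indicator (X n) ω := by
          intro ω
          have : φ n ω ∈ A ↔ ω ∈ A := by
            conv_rhs => rw [← hA2 n le_rfl]
            rfl
          by_cases hω : ω ∈ A
          · simp [hω, this.2 hω, heq]
          · simp [hω, mt this.1 hω]
        simp only [h2] at h1
        rw [integral_neg, integral_indicator hA1] at h1
        linarith
      simp only [Finset.sum_range_succ]
      rw [integral_add (integrable_finsetSum _ fun k _ => (hXi k).integrableOn)
        (hXi n).integrableOn, h0, add_zero]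
  have hbdd : ∀ᵐ ω ∂μ, ∀ n, |∑ k ∈ Finset.range (n + 1), X k ω - ∑ k ∈ Finset.range n, X k ω| ≤
      ((1 : NNReal) : ℝ) := by
    refine Eventually.of_forall fun ω n => ?_
    rw [Finset.sum_range_succ, add_sub_cancel_left, habs]
    rfl
  -- A martingale with bounded increments that is bounded below is almost surely bounded above and
  -- convergent, which steps of modulus one exclude.
  filter_upwards [hmart.bddAbove_range_iff_bddBelow_range hbdd,
    hmart.submartingale.bddAbove_iff_exists_tendsto hbdd] with ω h1 h2 h3
  obtain ⟨c, hc⟩ := h2.1 (h1.2 h3)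
  have h4 := ((tendsto_add_atTop_iff_nat 1).2 hc).sub hc
  simp only [Finset.sum_range_succ, add_sub_cancel_left, sub_self] at h4
  have h5 := h4.abs
  simp only [habs, abs_zero] at h5
  exact one_ne_zero (tendsto_nhds_unique tendsto_const_nhds h5)

/-! ### Symmetries of the uniform product measures -/

theorem map_uniformOn_univ {k : ℕ} (e : Equiv.Perm (Fin k)) :
    (uniformOn (Set.univ : Set (Fin k))).map e = uniformOn Set.univ := by
  refine Measure.ext_of_singleton fun b => ?_
  have : e ⁻¹' {b} = {e.symm b} := by
    ext a
    simp [Equiv.eq_symm_apply]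
  rw [Measure.map_apply (measurable_of_countable _) (measurableSet_singleton b), this,
    uniformOn_univ, uniformOn_univ, Measure.count_singleton, Measure.count_singleton]

/-- Letterwise permutations preserve the symmetric product measure. -/
theorem measurePreserving_infinitePi_uniformOn {k : ℕ} [NeZero k] (e : ℤ → Equiv.Perm (Fin k)) :
    MeasurePreserving (fun (z : ℤ → Fin k) i => e i (z i))
      (Measure.infinitePi fun _ => uniformOn Set.univ)
      (Measure.infinitePi fun _ => uniformOn Set.univ) := by
  refine ⟨measurable_pi_lambda _ fun i =>
    (measurable_of_countable (e i)).comp (measurable_pi_apply i), ?_⟩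
  rw [Measure.infinitePi_map_pi _ (f := fun i => ⇑(e i)) fun i => measurable_of_countable (e i)]
  simp only [map_uniformOn_univ]

/-- Permutations of the coordinates preserve the symmetric product measure. -/
theorem measurePreserving_comp_perm {k : ℕ} [NeZero k] (σ : Equiv.Perm ℤ) :
    MeasurePreserving (fun z : ℤ → Fin k => z ∘ σ)
      (Measure.infinitePi fun _ => uniformOn Set.univ)
      (Measure.infinitePi fun _ => uniformOn Set.univ) := by
  refine ⟨measurable_pi_lambda _ fun i => measurable_pi_apply (σ i), ?_⟩
  have := Measure.infinitePi_map_piCongrLeft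
    (fun _ : ℤ => uniformOn (Set.univ : Set (Fin k))) σ.symm
  convert this using 2
  ext z i
  obtain ⟨j, rfl⟩ := σ.symm.surjective i
  rw [MeasurableEquiv.coe_piCongrLeft, Equiv.piCongrLeft_apply_apply]
  simp

instance : IsProbabilityMeasure μ₁ := by
  unfold μ₁
  infer_instance

instance {m : ℕ} [NeZero m] : IsProbabilityMeasure (μ₂ m) := by
  unfold μ₂
  infer_instance

/-- Flipping the bit at `i`. -/
def flip (i : ℤ) (z : ℤ → Fin 2) (j : ℤ) : Fin 2 := if j = i then Equiv.swap 0 1 (z j) else z j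

theorem measurePreserving_flip (i : ℤ) : MeasurePreserving (flip i) μ₁ μ₁ := by
  have := measurePreserving_infinitePi_uniformOn (k := 2)
    fun j => if j = i then Equiv.swap 0 1 else Equiv.refl _
  have e : flip i = fun z j => (if j = i then Equiv.swap 0 1 else Equiv.refl (Fin 2)) (z j) := by
    ext1 z
    ext1 j
    unfold flip
    split_ifs <;> rfl
  rw [e]
  exact this

theorem rsgn_flip_of_ne {i j : ℤ} (h : j ≠ i) (z : ℤ → Fin 2) : rsgn j (flip i z) = rsgn j z := by
  simp [rsgn, flip, h]

theorem rsgn_flip_self (i : ℤ) (z : ℤ → Fin 2) : rsgn i (flip i z) = -rsgn i z := by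
  rcases fin_two_cases (z i) with h | h <;> simp [rsgn, flip, h, sgn]

theorem exists_le_of_not_bddBelow {h : ℤ → ℤ} {f : ℕ → ℝ} {e : ℕ → ℤ}
    (hf : ∀ n, f n = h (e n)) (hb : ¬ BddBelow (Set.range f)) (M : ℤ) (K : ℕ) :
    ∃ n, K ≤ n ∧ h (e n) ≤ M := by
  by_contra! hcon
  obtain ⟨b, hbd⟩ := ((Finset.range K).image f).bddBelow
  refine hb ⟨min b M, ?_⟩
  rintro _ ⟨n, rfl⟩
  rcases lt_or_ge n K with hn | hn
  · exact (min_le_left _ _).trans (hbd (by simpa using ⟨n, hn, rfl⟩))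
  · refine (min_le_right _ _).trans ?_
    change (M : ℝ) ≤ f n
    rw [hf]
    exact_mod_cast (hcon n hn).le

theorem ae_unbounded_μ₁ : ∀ᵐ z ∂μ₁, Unbounded (bitHeight z) := by
  have h1 := ae_not_bddBelow_of_flip (μ := μ₁) (X := fun n => rsgn n) (fun n => measurable_rsgn n)
    (fun n => abs_rsgn n) (φ := fun n => flip n) (fun n => measurePreserving_flip n)
    (fun n k z hk => rsgn_flip_of_ne (by exact_mod_cast hk) z) (fun n z => rsgn_flip_self n z)
  -- Walking left, `H_{-(n+1)} = H_{-n} - sgn z_{-1-n}`, hence the sign and the index.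
  have h2 := ae_not_bddBelow_of_flip (μ := μ₁) (X := fun n z => -rsgn (-1 - n) z)
    (fun n => (measurable_rsgn _).neg) (fun n z => by rw [abs_neg, abs_rsgn])
    (φ := fun n => flip (-1 - n)) (fun n => measurePreserving_flip _)
    (fun n k z hk => by
      rw [rsgn_flip_of_ne]
      omega) (fun n z => by rw [rsgn_flip_self])
  filter_upwards [h1, h2] with z h1 h2
  constructor
  · intro M N
    obtain ⟨n, hn, hn'⟩ := exists_le_of_not_bddBelow (h := bitHeight z) (e := fun n => n)
      (fun n => by
        induction n with
        | zero => simp [bitHeight_zero]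
        | succ n ih =>
          simp only [Finset.sum_range_succ] at ih ⊢
          rw [ih]
          push_cast
          rw [bitHeight_succ]
          push_cast
          rfl) h1 M N.toNat
    exact ⟨n, by omega, hn'⟩
  · intro M N
    obtain ⟨n, hn, hn'⟩ := exists_le_of_not_bddBelow (h := bitHeight z) (e := fun n => -n)
      (fun n => by
        induction n with
        | zero => simp [bitHeight_zero]
        | succ n ih =>
          simp only [Finset.sum_range_succ] at ih ⊢
          have := bitHeight_succ z (-1 - n)
          have e : (-1 - (n : ℤ) + 1) = -n := by ring
          have e' : (-((n + 1 : ℕ) : ℤ)) = -1 - n := by push_cast; ring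
          rw [e] at this
          rw [ih, this, e']
          push_cast
          rw [rsgn]
          ring) h2 M (-N).toNat
    exact ⟨-n, by omega, hn'⟩

/-! ## Measurability -/

theorem measurable_bitHeight (i : ℤ) : Measurable fun z : ℤ → Fin 2 => bitHeight z i := by
  have h : ∀ j : ℤ, Measurable fun z : ℤ → Fin 2 => sgn (z j) := fun j =>
    (measurable_of_countable sgn).comp (measurable_pi_apply j)
  unfold bitHeight cocycle
  split_ifs
  · exact Finset.measurable_fun_sum _ fun j _ => h j
  · exact (Finset.measurable_fun_sum _ fun j _ => h j).neg

theorem measurableSet_unbounded : MeasurableSet {z : ℤ → Fin 2 | Unbounded (bitHeight z)} := by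
  have h : ∀ i M, MeasurableSet {z : ℤ → Fin 2 | bitHeight z i ≤ M} := fun i M =>
    measurableSet_le (measurable_bitHeight i) measurable_const
  simp only [Unbounded, measurableSet_setOfPred]
  refine Measurable.and ?_ ?_ <;>
    exact Measurable.forall fun M => Measurable.forall fun N => Measurable.exists fun i =>
      Measurable.and measurable_const (measurableSet_setOfPred.1 (h i M))

/-- This writes `ε` through countably many height comparisons, for every `z`, so that it is
measurable. The second alternative is the default: the supremum of the empty set of integers is `0`.
-/
theorem ε_eq_iff (z : ℤ → Fin 2) (n k : ℤ) : ε z n = k ↔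
    (k < n ∧ bitHeight z k ≤ bitHeight z (n + 1) ∧
      ∀ l, k < l → l < n → bitHeight z (n + 1) < bitHeight z l) ∨
    (k = 0 ∧ ∀ l, l < n → bitHeight z (n + 1) < bitHeight z l) := by
  rcases Set.eq_empty_or_nonempty {l : ℤ | l < n ∧ bitHeight z l ≤ bitHeight z (n + 1)} with h | h
  · have h' : ∀ l, l < n → bitHeight z (n + 1) < bitHeight z l := fun l hl => by
      by_contra hlt
      exact (h ▸ (⟨hl, not_lt.1 hlt⟩ : l ∈ {l : ℤ | l < n ∧ bitHeight z l ≤ bitHeight z (n + 1)}) :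
        l ∈ (∅ : Set ℤ))
    have h0 : ε z n = 0 := by
      unfold ε
      rw [h, Int.csSup_empty]
    rw [h0]
    constructor
    · rintro rfl
      exact Or.inr ⟨rfl, h'⟩
    · rintro (⟨h1, h2, -⟩ | ⟨rfl, -⟩)
      · exact absurd h2 (not_le.2 (h' k h1))
      · rfl
  · have hmem := Int.csSup_mem h ⟨n, fun l hl => hl.1.le⟩
    change ε z n < n ∧ bitHeight z (ε z n) ≤ _ at hmem
    constructor
    · rintro rfl
      exact Or.inl ⟨hmem.1, hmem.2, fun l hl hln => lt_bitHeight_of_ε_lt hl hln⟩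
    · rintro (⟨h1, h2, h3⟩ | ⟨-, h1⟩)
      · exact prev_eq h1 h2 h3
      · exact absurd hmem.2 (not_le.2 (h1 _ hmem.1))

theorem measurable_ε (n : ℤ) : Measurable fun z : ℤ → Fin 2 => ε z n := by
  refine measurable_to_countable' fun k => ?_
  have e : (fun z : ℤ → Fin 2 => ε z n) ⁻¹' {k} = {z | ε z n = k} := rfl
  have hle : ∀ i j, Measurable fun z : ℤ → Fin 2 => bitHeight z i ≤ bitHeight z j := fun i j =>
    measurableSet_setOfPred.1 (measurableSet_le (measurable_bitHeight i) (measurable_bitHeight j))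
  have hlt : ∀ i j, Measurable fun z : ℤ → Fin 2 => bitHeight z i < bitHeight z j := fun i j =>
    measurableSet_setOfPred.1 (measurableSet_lt (measurable_bitHeight i) (measurable_bitHeight j))
  rw [e]
  simp only [ε_eq_iff, measurableSet_setOfPred]
  refine Measurable.or ?_ ?_
  · exact measurable_const.and ((hle _ _).and (Measurable.forall fun l =>
      measurable_const.imp (measurable_const.imp (hlt _ _))))
  · exact measurable_const.and (Measurable.forall fun l => measurable_const.imp (hlt _ _))

theorem measurable_γ (k : ℤ) : Measurable fun z : ℤ → Fin 2 => γ z k := by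
  have h : ∀ j : ℤ, Measurable fun z : ℤ → Fin 2 => ((z j : ℕ) : ℤ) := fun j =>
    (measurable_of_countable fun b : Fin 2 => ((b : ℕ) : ℤ)).comp (measurable_pi_apply j)
  unfold γ
  split_ifs
  · exact Finset.measurable_fun_sum _ fun j _ => h j
  · exact (Finset.measurable_fun_sum _ fun j _ => h j).neg

theorem measurable_eval_index {Ω : Type*} [MeasurableSpace Ω] {m : ℕ} {i : Ω → ℤ}
    {t : Ω → ℤ → Fin m} (hi : Measurable i) (ht : Measurable t) :
    Measurable fun ω => t ω (i ω) := by
  have : Measurable fun q : ℤ × (ℤ → Fin m) => q.2 q.1 :=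
    measurable_from_prod_countable_right fun k => measurable_pi_apply k
  exact this.comp (hi.prodMk ht)

theorem measurable_letter {Ω : Type*} [MeasurableSpace Ω] {m : ℕ} {z : Ω → ℤ → Fin 2}
    (hz : Measurable z) {f g : Ω → Fin m} (hf : Measurable f) (hg : Measurable g) (n : ℤ) :
    Measurable fun ω => if z ω n = 1 then α (f ω) else β (g ω) :=
  Measurable.ite (((measurable_pi_apply n).comp hz) (measurableSet_singleton (1 : Fin 2)))
    ((measurable_of_countable α).comp hf) ((measurable_of_countable β).comp hg)

theorem measurable_code {Ω : Type*} [MeasurableSpace Ω] {m : ℕ} {z : Ω → ℤ → Fin 2}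
    {t : Ω → ℤ → Fin m} (hz : Measurable z) (ht : Measurable t) :
    Measurable fun ω => code (z ω) (t ω) :=
  measurable_pi_lambda _ fun n => measurable_letter hz ((measurable_pi_apply n).comp ht)
    (measurable_eval_index ((measurable_ε n).comp hz) ht) n

theorem measurable_F {m : ℕ} : Measurable (F : (ℤ → Fin 2) × (ℤ → Fin m) → ℤ → Letter m) := by
  refine measurable_pi_lambda _ fun n => measurable_letter measurable_fst
    (measurable_eval_index ((measurable_γ n).comp measurable_fst) measurable_snd)
    (measurable_eval_index ?_ measurable_snd) n
  have h : Measurable fun q : ℤ × (ℤ → Fin 2) => γ q.2 q.1 :=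
    measurable_from_prod_countable_right fun k => measurable_γ k
  exact h.comp (((measurable_ε n).comp measurable_fst).prodMk measurable_fst)

instance {m : ℕ} : MeasurableSingletonClass (Letter m) where
  measurableSet_singleton a := by
    rcases a with a | a
    · rw [← Set.image_singleton]
      exact (measurableSet_singleton a).inl_image
    · rw [← Set.image_singleton]
      exact measurableSet_inr_image.2 (measurableSet_singleton a)

theorem measurable_bits {m : ℕ} : Measurable (bits : (ℤ → Letter m) → ℤ → Fin 2) :=
  measurable_pi_lambda _ fun n => (measurable_of_countable fun a : Letter m =>
    (Sum.elim (fun _ => 1) (fun _ => 0) a : Fin 2)).comp (measurable_pi_apply n)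

theorem measurable_typ {m : ℕ} : Measurable (typ : (ℤ → Letter m) → ℤ → Fin m) :=
  measurable_pi_lambda _ fun n => (measurable_of_countable fun a : Letter m =>
    (Sum.elim id id a : Fin m)).comp (measurable_pi_apply n)

/-- The monoid congruence is traded for a fixed-point equation of a Borel map, which makes `B m {⊥}
{⊥}` Borel. -/
theorem mem_B_iff_code {m : ℕ} [NeZero m] (x : ℤ → Letter m) :
    x ∈ B m {⊥} {⊥} ↔ Unbounded (bitHeight (bits x)) ∧ code (bits x) (typ x) = x := by
  refine ⟨fun hx => ⟨((mem_B_iff x).1 hx).2, code_eq_of_mem_B hx⟩, fun ⟨h1, h2⟩ => ?_⟩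
  rw [← h2]
  exact code_mem_B h1 _

theorem measurableSet_B {m : ℕ} [NeZero m] : MeasurableSet (B m {⊥} {⊥}) := by
  have e : B m {⊥} {⊥} = bits ⁻¹' {z | Unbounded (bitHeight z)} ∩
      {x | code (bits x) (typ x) = x} := Set.ext mem_B_iff_code
  rw [e]
  exact (measurable_bits measurableSet_unbounded).inter
    (measurableSet_eq_fun (measurable_code measurable_bits measurable_typ) measurable_id)

section

/-! ## Laws given by independent uniform types -/

/-- The law of the point with random bits of law `ρ` and independent uniform types. -/
def codeMeasure (m : ℕ) (ρ : Measure (ℤ → Fin 2)) : Measure (ℤ → Letter m) :=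
  (ρ.prod (μ₂ m)).map fun p => code p.1 p.2

theorem measurable_code_prod {m : ℕ} :
    Measurable fun p : (ℤ → Fin 2) × (ℤ → Fin m) => code p.1 p.2 :=
  measurable_code measurable_fst measurable_snd

theorem codeMeasure_apply {m : ℕ} [NeZero m] (ρ : Measure (ℤ → Fin 2)) [SFinite ρ]
    {E : Set (ℤ → Letter m)} (hE : MeasurableSet E) :
    codeMeasure m ρ E = ∫⁻ z, ∫⁻ t, E.indicator 1 (code z t) ∂(μ₂ m) ∂ρ := by
  have hf : Measurable fun p : (ℤ → Fin 2) × (ℤ → Fin m) =>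
      E.indicator (1 : (ℤ → Letter m) → ENNReal) (code p.1 p.2) :=
    (measurable_one.indicator hE).comp measurable_code_prod
  rw [codeMeasure, ← lintegral_indicator_one hE,
    lintegral_map (measurable_one.indicator hE) measurable_code_prod,
    lintegral_prod _ hf.aemeasurable]

/-! ### Comparison of `F` with `code` -/

theorem measurePreserving_add {m : ℕ} [NeZero m] (b : ℤ → Fin m) :
    MeasurePreserving (fun t => t + b) (μ₂ m) (μ₂ m) :=
  measurePreserving_infinitePi_uniformOn fun i => Equiv.addRight (b i)

theorem measurable_add_types {Ω : Type*} [MeasurableSpace Ω] {m : ℕ} {f g : Ω → Fin m}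
    (hf : Measurable f) (hg : Measurable g) : Measurable fun ω => f ω + g ω :=
  (measurable_of_countable fun q : Fin m × Fin m => q.1 + q.2).comp (hf.prodMk hg)

/-- Distinct ones read distinct coordinates of the type sequence, so `γ` imposes no relation among
the types of opening letters. -/
theorem γ_lt_of_lt {z : ℤ → Fin 2} {n k : ℤ} (hn : z n = 1) (hk : z k = 1) (h : n < k) :
    γ z n < γ z k := by
  have hnn : ∀ s : Finset ℤ, 0 ≤ ∑ i ∈ s, ((z i : ℕ) : ℤ) := fun s =>
    Finset.sum_nonneg fun i _ => Int.natCast_nonneg _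
  unfold γ
  split_ifs with h1 h2 h2
  · refine Finset.sum_lt_sum_of_subset (i := k) (Finset.Icc_subset_Icc_right h.le) ?_ ?_ ?_ ?_
    · simp; omega
    · simp; omega
    · simp [hk]
    · exact fun j _ _ => Int.natCast_nonneg _
  · omega
  · have : 0 < ∑ i ∈ Finset.Icc 0 k, ((z i : ℕ) : ℤ) :=
      Finset.sum_pos' (fun i _ => Int.natCast_nonneg _) ⟨k, by simp; omega, by simp [hk]⟩
    have := hnn (Finset.Icc n (-1))
    omega
  · refine neg_lt_neg (Finset.sum_lt_sum_of_subset (i := n) (Finset.Icc_subset_Icc_left h.le)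
      ?_ ?_ ?_ ?_)
    · simp; omega
    · simp; omega
    · simp [hn]
    · exact fun j _ _ => Int.natCast_nonneg _

theorem exists_comp_γ_eq {m : ℕ} [NeZero m] (z : ℤ → Fin 2) (b : ℤ → Fin m) :
    ∃ b' : ℤ → Fin m, ∀ n, z n = 1 → b' (γ z n) = b n := by
  have hinj : Function.Injective fun n : {n // z n = 1} => γ z n := by
    rintro ⟨n, hn⟩ ⟨k, hk⟩ h
    rcases lt_trichotomy n k with h' | rfl | h'
    · exact absurd h (γ_lt_of_lt hn hk h').ne
    · rfl
    · exact absurd h (γ_lt_of_lt hk hn h').ne'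
  exact ⟨Function.extend (fun n : {n // z n = 1} => γ z n) (fun n => b n) 0,
    fun n hn => hinj.extend_apply _ _ (⟨n, hn⟩ : {n // z n = 1})⟩

theorem F_eq_code {m : ℕ} (z : ℤ → Fin 2) (a : ℤ → Fin m) :
    F (z, a) = code z fun n => a (γ z n) := rfl

/-- Add a second uniform sequence `b` to the types. For fixed `b` this is a translation of `a` as
far as the ones are concerned; for fixed `a` the sum is uniform on `ℤ`. Fubini equates the two
averages. -/
theorem lintegral_F_eq {m : ℕ} [NeZero m] {z : ℤ → Fin 2} (hz : Unbounded (bitHeight z))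
    {f : (ℤ → Letter m) → ENNReal} (hf : Measurable f) :
    ∫⁻ a, f (F (z, a)) ∂(μ₂ m) = ∫⁻ t, f (code z t) ∂(μ₂ m) := by
  have hcomp : Measurable fun a : ℤ → Fin m => fun n => a (γ z n) :=
    measurable_pi_lambda _ fun n => measurable_pi_apply _
  have hF : Measurable fun a : ℤ → Fin m => f (F (z, a)) :=
    hf.comp (measurable_F.comp measurable_prodMk_left)
  have hcode : Measurable fun t : ℤ → Fin m => f (code z t) :=
    hf.comp (measurable_code measurable_const measurable_id)
  have h1 : ∀ b : ℤ → Fin m,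
      ∫⁻ a, f (code z ((fun n => a (γ z n)) + b)) ∂(μ₂ m) = ∫⁻ a, f (F (z, a)) ∂(μ₂ m) := by
    intro b
    obtain ⟨b', hb'⟩ := exists_comp_γ_eq z b
    rw [← (measurePreserving_add b').lintegral_comp hF]
    refine lintegral_congr fun a => ?_
    rw [F_eq_code]
    congr 1
    refine code_congr hz fun n hn => ?_
    simp only [Pi.add_apply]
    rw [hb' n hn]
  have h2 : ∀ a : ℤ → Fin m,
      ∫⁻ b, f (code z ((fun n => a (γ z n)) + b)) ∂(μ₂ m) = ∫⁻ t, f (code z t) ∂(μ₂ m) := by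
    intro a
    rw [← (measurePreserving_add fun n => a (γ z n)).lintegral_comp hcode]
    simp only [add_comm]
  have hm : Measurable fun p : (ℤ → Fin m) × (ℤ → Fin m) =>
      f (code z ((fun n => p.1 (γ z n)) + p.2)) := by
    refine hf.comp (measurable_code measurable_const ?_)
    refine measurable_pi_lambda _ fun n => ?_
    exact measurable_add_types ((measurable_pi_apply (γ z n)).comp measurable_fst)
      ((measurable_pi_apply n).comp measurable_snd)
  have := lintegral_lintegral_swap (μ := μ₂ m) (ν := μ₂ m)
    (f := fun a b => f (code z ((fun n => a (γ z n)) + b))) hm.aemeasurable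
  simpa [h1, h2] using this.symm

theorem μTilde_eq_codeMeasure (m : ℕ) [NeZero m] : μTilde m = codeMeasure m μ₁ := by
  have hS : (μ₁.prod (μ₂ m)).restrict (S ×ˢ Set.univ) = μ₁.prod (μ₂ m) := by
    refine Measure.restrict_eq_self_of_ae_mem ?_
    have := (Measure.quasiMeasurePreserving_fst (μ := μ₁) (ν := μ₂ m)).ae ae_unbounded_μ₁
    filter_upwards [this] with p hp
    exact ⟨(mem_S_iff _).2 hp, trivial⟩
  ext E hE
  have hi : Measurable (E.indicator (1 : (ℤ → Letter m) → ENNReal)) := measurable_one.indicator hE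
  rw [codeMeasure_apply _ hE, μTilde, hS, ← lintegral_indicator_one hE,
    lintegral_map hi measurable_F,
    lintegral_prod (fun p => E.indicator 1 (F p)) (hi.comp measurable_F).aemeasurable]
  refine lintegral_congr_ae ?_
  filter_upwards [ae_unbounded_μ₁] with z hz using lintegral_F_eq hz hi

instance {m : ℕ} [NeZero m] (ρ : Measure (ℤ → Fin 2)) [IsProbabilityMeasure ρ] :
    IsProbabilityMeasure (codeMeasure m ρ) :=
  Measure.isProbabilityMeasure_map measurable_code_prod.aemeasurable

/-! ## Finitary changes of the coordinates -/

/-- The coordinates are permuted by `σ`, and `a` is added to the types. -/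
def act {m : ℕ} (σ : Equiv.Perm ℤ) (a : ℤ → Fin m) (x : ℤ → Letter m) : ℤ → Letter m :=
  code (bits x ∘ σ) fun n => typ x (σ n) + a n

theorem measurable_act {m : ℕ} (σ : Equiv.Perm ℤ) (a : ℤ → Fin m) : Measurable (act σ a) := by
  refine measurable_code (measurable_pi_lambda _ fun n => ?_) (measurable_pi_lambda _ fun n => ?_)
  · exact (measurable_pi_apply (σ n)).comp measurable_bits
  · exact (measurable_of_countable fun b : Fin m => b + a n).comp
      ((measurable_pi_apply (σ n)).comp measurable_typ)

@[simp] theorem bits_act {m : ℕ} (σ : Equiv.Perm ℤ) (a : ℤ → Fin m) (x : ℤ → Letter m) :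
    bits (act σ a x) = bits x ∘ σ := bits_code _ _

/-- `σ` moves only coordinates in `[-N, N]`. -/
def FixesOff (N : ℕ) (σ : Equiv.Perm ℤ) : Prop := ∀ k : ℤ, (N : ℤ) < |k| → σ k = k

theorem FixesOff.mem_window_iff {N : ℕ} {σ : Equiv.Perm ℤ} (hσ : FixesOff N σ) (k : ℤ) :
    k ∈ Finset.Ico (-N : ℤ) (N + 1) ↔ σ k ∈ Finset.Ico (-N : ℤ) (N + 1) := by
  have e : ∀ k : ℤ, k ∈ Finset.Ico (-N : ℤ) (N + 1) ↔ ¬ (N : ℤ) < |k| := fun k => by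
    rw [Finset.mem_Ico, not_lt, abs_le]
    omega
  rw [e, e, not_iff_not]
  constructor
  · intro h
    rwa [hσ k h]
  · intro h
    rwa [σ.injective (hσ _ h)] at h

theorem FixesOff.unbounded {N : ℕ} {σ : Equiv.Perm ℤ} (hσ : FixesOff N σ) {z : ℤ → Fin 2}
    (hz : Unbounded (bitHeight z)) : Unbounded (bitHeight (z ∘ σ)) :=
  hz.congr fun k hk => by rw [Function.comp_apply, hσ k hk]

theorem act_code {m : ℕ} {N : ℕ} {σ : Equiv.Perm ℤ} (hσ : FixesOff N σ) (a : ℤ → Fin m)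
    {z : ℤ → Fin 2} (hz : Unbounded (bitHeight z)) (t : ℤ → Fin m) :
    act σ a (code z t) = code (z ∘ σ) fun n => t (σ n) + a n := by
  unfold act
  rw [bits_code]
  exact code_congr (hσ.unbounded hz) fun n hn => by rw [typ_code_of_one (z := z) t hn]

/-- A letter depends on `a` only at its own place and at that of its partner; this locality drives
the limit in `map_act_one`. -/
theorem act_one_congr {m : ℕ} {a b : ℤ → Fin m} {x : ℤ → Letter m} {n : ℤ} (h : a n = b n)
    (h' : a (ε (bits x) n) = b (ε (bits x) n)) : act 1 a x n = act 1 b x n := by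
  change (if bits x n = 1 then α (typ x n + a n) else β (typ x (ε (bits x) n) + a (ε (bits x) n))) =
    if bits x n = 1 then α (typ x n + b n) else β (typ x (ε (bits x) n) + b (ε (bits x) n))
  rw [h, h']

variable {m : ℕ} [NeZero m]

theorem act_mem_B {N : ℕ} {σ : Equiv.Perm ℤ} (hσ : FixesOff N σ) (a : ℤ → Fin m)
    {x : ℤ → Letter m} (hx : x ∈ B m {⊥} {⊥}) : act σ a x ∈ B m {⊥} {⊥} :=
  code_mem_B (hσ.unbounded ((mem_B_iff x).1 hx).2) _

theorem act_symm_act (σ : Equiv.Perm ℤ) (a : ℤ → Fin m)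
    {x : ℤ → Letter m} (hx : x ∈ B m {⊥} {⊥}) :
    act σ.symm (fun n => -a (σ.symm n)) (act σ a x) = x := by
  have hz := ((mem_B_iff x).1 hx).2
  rw [act, bits_act]
  conv_rhs => rw [← code_eq_of_mem_B hx]
  have e : (bits x ∘ σ) ∘ σ.symm = bits x := by ext n; simp
  rw [e]
  refine code_congr hz fun n hn => ?_
  rw [act, typ_code_of_one _ (by simpa using hn)]
  simp

theorem injOn_act (σ : Equiv.Perm ℤ) (a : ℤ → Fin m) :
    Set.InjOn (act σ a) (B m {⊥} {⊥}) := fun x hx y hy h => by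
  rw [← act_symm_act σ a hx, h, act_symm_act σ a hy]

/-- A permutation of the window keeps its sum of signs, so `exists_code_eq` applies. -/
theorem isHolonomy_act {N : ℕ} {σ : Equiv.Perm ℤ} (hσ : FixesOff N σ) {a : ℤ → Fin m}
    (ha : ∀ k : ℤ, (N : ℤ) < |k| → a k = 0) {A : Set (ℤ → Letter m)} (hA : MeasurableSet A)
    (hAB : A ⊆ B m {⊥} {⊥}) : IsHolonomy (shiftSpace m) A (act σ a) where
  measurableSet := hA
  subset := fun x hx => (hAB hx).1
  measurable := (measurable_act σ a).comp measurable_subtype_coe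
  injOn := (injOn_act σ a).mono hAB
  mem_doubleTail := by
    intro x hx
    have hxB := hAB hx
    refine ⟨hxB.1, (act_mem_B hσ a hxB).1, ?_⟩
    obtain ⟨R, hR⟩ := exists_code_eq (z := bits x) (z' := bits x ∘ σ) (t := typ x)
      (t' := fun n => typ x (σ n) + a n) (N := N) ((mem_B_iff x).1 hxB).2
      (fun k hk => by rw [Function.comp_apply, hσ k hk])
      (fun k hk => by rw [hσ k hk, ha k hk, add_zero])
      (Finset.sum_equiv σ hσ.mem_window_iff fun i _ => rfl)
    rw [code_eq_of_mem_B hxB] at hR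
    exact ⟨R, hR⟩

/-! ## Uniqueness -/

section Uniqueness

variable {ν : Measure (ℤ → Letter m)} [IsProbabilityMeasure ν]

theorem measurePreserving_act (hν : IsDoubleTailInvariant (shiftSpace m) ν)
    (hB : ∀ᵐ x ∂ν, x ∈ B m {⊥} {⊥}) {N : ℕ} {σ : Equiv.Perm ℤ} (hσ : FixesOff N σ)
    {a : ℤ → Fin m} (ha : ∀ k : ℤ, (N : ℤ) < |k| → a k = 0) :
    MeasurePreserving (act σ a) ν ν := by
  have hm := measurable_act σ a
  refine ⟨hm, ?_⟩
  -- Invariance is needed only as an inequality, because two probability measures with one below the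
  -- other coincide.
  have hle : ∀ E, MeasurableSet E → ν.map (act σ a) E ≤ ν E := by
    intro E hE
    rw [Measure.map_apply hm hE]
    have h1 : ν (act σ a ⁻¹' E) = ν (act σ a ⁻¹' E ∩ B m {⊥} {⊥}) :=
      measure_congr (by
        filter_upwards [hB] with x hx
        exact propext (and_iff_left hx).symm)
    rw [h1, hν _ _ (isHolonomy_act hσ ha ((hm hE).inter measurableSet_B) Set.inter_subset_right)]
    refine measure_mono ?_
    rintro _ ⟨x, ⟨hx, -⟩, rfl⟩
    exact hx
  have : IsProbabilityMeasure (ν.map (act σ a)) :=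
    Measure.isProbabilityMeasure_map hm.aemeasurable
  exact Measure.eq_of_le_of_isProbabilityMeasure (Measure.le_iff.2 hle)

theorem exchangeable_map_bits (hν : IsDoubleTailInvariant (shiftSpace m) ν)
    (hB : ∀ᵐ x ∂ν, x ∈ B m {⊥} {⊥}) : Exchangeable (ν.map bits) := by
  intro i j
  have hm : Measurable fun z : ℤ → Fin 2 => z ∘ Equiv.swap i j :=
    measurable_pi_lambda _ fun n => measurable_pi_apply _
  refine ⟨hm, ?_⟩
  have hσ : FixesOff (i.natAbs + j.natAbs) (Equiv.swap i j) := fun k hk =>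
    Equiv.swap_apply_of_ne_of_ne (by rintro rfl; rw [Int.abs_eq_natAbs] at hk; omega)
      (by rintro rfl; rw [Int.abs_eq_natAbs] at hk; omega)
  have h := (measurePreserving_act hν hB hσ (a := 0) fun _ _ => rfl)
  conv_rhs => rw [← h.map_eq]
  rw [Measure.map_map hm measurable_bits, Measure.map_map measurable_bits h.measurable]
  congr 1
  ext1 x
  exact (bits_act _ _ x).symm

theorem map_bits_eq (hν : IsDoubleTailInvariant (shiftSpace m) ν)
    (hB : ∀ᵐ x ∂ν, x ∈ B m {⊥} {⊥}) : ν.map bits = μ₁ := by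
  have : IsProbabilityMeasure (ν.map bits) :=
    Measure.isProbabilityMeasure_map measurable_bits.aemeasurable
  refine (exchangeable_map_bits hν hB).eq_μ₁ ?_
  rw [ae_map_iff measurable_bits.aemeasurable measurableSet_unbounded]
  filter_upwards [hB] with x hx using ((mem_B_iff x).1 hx).2

/-- The sequence `a`, cut off outside `[-N, N]`. -/
def cutoff (a : ℤ → Fin m) (N : ℕ) (k : ℤ) : Fin m := if (N : ℤ) < |k| then 0 else a k

/-- For `a` of infinite support `act 1 a` need not be a holonomy. The cutoffs of `a` give
holonomies, and on each cylinder their indicators stabilise pointwise. -/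
theorem map_act_one (hν : IsDoubleTailInvariant (shiftSpace m) ν)
    (hB : ∀ᵐ x ∂ν, x ∈ B m {⊥} {⊥}) (a : ℤ → Fin m) : ν.map (act 1 a) = ν := by
  have hm := fun b : ℤ → Fin m => measurable_act 1 b
  have : IsProbabilityMeasure (ν.map (act 1 a)) :=
    Measure.isProbabilityMeasure_map (hm a).aemeasurable
  refine ext_of_generate_finite (measurableCylinders fun _ : ℤ => Letter m)
    generateFrom_measurableCylinders.symm isPiSystem_measurableCylinders ?_ (by simp)
  intro E hE
  have hEm : MeasurableSet E := .of_mem_measurableCylinders hE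
  obtain ⟨s, E₀, -, rfl⟩ := (mem_measurableCylinders E).1 hE
  rw [Measure.map_apply (hm a) hEm]
  have hN : ∀ N, ν (act 1 (cutoff a N) ⁻¹' cylinder s E₀) = ν (cylinder s E₀) := fun N =>
    (measurePreserving_act hν hB (N := N) (σ := 1) (fun _ _ => rfl)
      (fun k hk => if_pos hk)).measure_preimage hEm.nullMeasurableSet
  have hlim : Tendsto (fun N => ν (act 1 (cutoff a N) ⁻¹' cylinder s E₀)) atTop
      (nhds (ν (act 1 a ⁻¹' cylinder s E₀))) := by
    refine tendsto_measure_of_ae_tendsto_indicator_of_isFiniteMeasure atTop (hm a hEm)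
      (fun N => hm _ hEm) (Eventually.of_forall fun x => ?_)
    have h1 : ∀ k : ℤ, ∀ᶠ N : ℕ in atTop, cutoff a N k = a k := fun k => by
      filter_upwards [eventually_ge_atTop k.natAbs] with N hN
      exact if_neg (by rw [Int.abs_eq_natAbs]; omega)
    have h2 : ∀ᶠ N : ℕ in atTop, ∀ n ∈ s, act 1 (cutoff a N) x n = act 1 a x n := by
      rw [eventually_all_finset]
      intro n _
      filter_upwards [h1 n, h1 (ε (bits x) n)] with N h h' using act_one_congr h h'
    filter_upwards [h2] with N hN
    have : s.restrict (act 1 (cutoff a N) x) = s.restrict (act 1 a x) :=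
      funext fun n => hN n n.2
    simp only [Set.mem_preimage, mem_cylinder, this]
  simp only [hN] at hlim
  exact tendsto_nhds_unique hlim tendsto_const_nhds |>.symm ▸ rfl

/-- Average the invariance under `act 1 a` over `a` of law `μ₂ m`: for each fixed `x` the types of
`act 1 a x` are then uniform, and only `bits x` is remembered. -/
theorem eq_codeMeasure (hν : IsDoubleTailInvariant (shiftSpace m) ν)
    (hB : ∀ᵐ x ∂ν, x ∈ B m {⊥} {⊥}) : ν = codeMeasure m (ν.map bits) := by
  ext E hE
  have hi : Measurable (E.indicator (1 : (ℤ → Letter m) → ENNReal)) := measurable_one.indicator hE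
  have : IsProbabilityMeasure (ν.map bits) :=
    Measure.isProbabilityMeasure_map measurable_bits.aemeasurable
  have hjoint : Measurable fun p : (ℤ → Fin 2) × (ℤ → Fin m) =>
      E.indicator (1 : (ℤ → Letter m) → ENNReal) (code p.1 p.2) := hi.comp measurable_code_prod
  rw [codeMeasure_apply _ hE, lintegral_map hjoint.lintegral_prod_right' measurable_bits]
  have h1 : ∀ a : ℤ → Fin m, ∫⁻ x, E.indicator 1 (act 1 a x) ∂ν = ν E := by
    intro a
    rw [← lintegral_map hi (measurable_act 1 a), map_act_one hν hB, lintegral_indicator_one hE]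
  have h2 : ∀ x : ℤ → Letter m, ∫⁻ a, E.indicator 1 (act 1 a x) ∂(μ₂ m) =
      ∫⁻ t, E.indicator 1 (code (bits x) t) ∂(μ₂ m) := by
    intro x
    have hx : Measurable fun t : ℤ → Fin m =>
        E.indicator (1 : (ℤ → Letter m) → ENNReal) (code (bits x) t) :=
      hi.comp (measurable_code measurable_const measurable_id)
    rw [← (measurePreserving_add (typ x)).lintegral_comp hx]
    refine lintegral_congr fun a => ?_
    have e : act 1 a x = code (bits x) (a + typ x) := by
      rw [add_comm]
      rfl
    rw [e]
  have hm : Measurable fun p : (ℤ → Fin m) × (ℤ → Letter m) =>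
      E.indicator (1 : (ℤ → Letter m) → ENNReal) (act 1 p.1 p.2) := by
    refine hi.comp (measurable_code (measurable_bits.comp measurable_snd)
      (measurable_pi_lambda _ fun n => ?_))
    exact measurable_add_types ((measurable_pi_apply n).comp (measurable_typ.comp measurable_snd))
      ((measurable_pi_apply n).comp measurable_fst)
  have := lintegral_lintegral_swap (μ := μ₂ m) (ν := ν)
    (f := fun a x => E.indicator (1 : (ℤ → Letter m) → ENNReal) (act 1 a x)) hm.aemeasurable
  simp only [h1, h2, lintegral_const, measure_univ, mul_one] at this
  exact this

end Uniqueness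

end

section

theorem mem_B_of_doubleTail {m : ℕ} {x x' : ℤ → Letter m} (h : (x, x') ∈ doubleTail (shiftSpace m))
    (hx : x ∈ B m {⊥} {⊥}) : x' ∈ B m {⊥} {⊥} := by
  obtain ⟨-, hx', N, hN⟩ := h
  refine (mem_B_iff x').2 ⟨hx', ((mem_B_iff x).1 hx).2.congr (N := N) fun k hk => ?_⟩
  have := hN k hk
  simp only at this
  rw [bits, bits, this]

theorem doubleTail_symm {m : ℕ} {x x' : ℤ → Letter m} (h : (x, x') ∈ doubleTail (shiftSpace m)) :
    (x', x) ∈ doubleTail (shiftSpace m) :=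
  ⟨h.2.1, h.1, h.2.2.imp fun _ hN k hk => (hN k hk).symm⟩

variable {m : ℕ} [NeZero m]

/-! ## Changes of a window that shift the heights -/

theorem bitHeight_eq_of_first {z : ℤ → Fin 2} {n h : ℤ} (h1 : h < bitHeight z n)
    (h2 : bitHeight z (n + 1) ≤ h) : z n = 0 ∧ bitHeight z (n + 1) = h := by
  rcases fin_two_cases (z n) with h0 | h0
  · rw [bitHeight_succ_of_zero h0] at h2 ⊢
    exact ⟨h0, by omega⟩
  · rw [bitHeight_succ_of_one h0] at h2
    omega

theorem exists_first_le {z : ℤ → Fin 2} (hz : Unbounded (bitHeight z)) {N h : ℤ}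
    (hN : h < bitHeight z N) : ∃ n, N ≤ n ∧ z n = 0 ∧ bitHeight z (n + 1) = h ∧
      ∀ l, N ≤ l → l ≤ n → h < bitHeight z l := by
  obtain ⟨i, ⟨hNi, hi⟩, hmin⟩ := Int.exists_least_of_bdd (P := fun i => N ≤ i ∧ bitHeight z i ≤ h)
    ⟨N, fun i hi => hi.1⟩ (hz.1 h N)
  have hne : N ≠ i := by
    rintro rfl
    omega
  have hl : ∀ l, N ≤ l → l ≤ i - 1 → h < bitHeight z l := fun l h1 h2 => by
    by_contra hlt
    have := hmin l ⟨h1, not_lt.1 hlt⟩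
    omega
  have h1 := hl (i - 1) (by omega) le_rfl
  have h2 := bitHeight_eq_of_first (n := i - 1) h1 (by rwa [sub_add_cancel])
  exact ⟨i - 1, by omega, h2.1, h2.2, hl⟩

/-- If two points agree off a window that shifts the heights, then, at each low level, the types of
two different opening letters left of the window agree. -/
theorem typ_prev_eq_of_shift {x x' : ℤ → Letter m} (hx : x ∈ B m {⊥} {⊥})
    (hx' : x' ∈ B m {⊥} {⊥}) {N : ℕ} (hxx : ∀ k : ℤ, (N : ℤ) < |k| → x k = x' k) {c d h : ℤ}
    (hc : ∀ k : ℤ, N < k → bitHeight (bits x') k = bitHeight (bits x) k + c)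
    (hd : ∀ k : ℤ, k ≤ -N → bitHeight (bits x') k = bitHeight (bits x) k + d)
    (h1 : ∀ k : ℤ, |k| ≤ (N + 1 : ℕ) → h < bitHeight (bits x) k)
    (h2 : ∀ k : ℤ, |k| ≤ (N + 1 : ℕ) → h + c < bitHeight (bits x') k) :
    typ x (prev (bits x) (-N) h) = typ x (prev (bits x) (-N) (h + (c - d))) := by
  have hz := ((mem_B_iff x).1 hx).2
  have hz' := ((mem_B_iff x').1 hx').2
  have habs : ∀ k : ℤ, -(N : ℤ) ≤ k → k ≤ N + 1 → |k| ≤ (N + 1 : ℕ) := fun k hk hk' =>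
    abs_le.2 ⟨by push_cast; omega, by push_cast; omega⟩
  -- The letter at `n` first brings the height of `x` down to `h` right of the window. Its partner
  -- is left of the window, as all heights in the window exceed `h`.
  obtain ⟨n, hNn, hn, hHn, hln⟩ := exists_first_le hz (h1 (N + 1) (habs _ (by omega) le_rfl))
  have hε : ε (bits x) n = prev (bits x) (-N) h := by
    have hp := prev_mem hz (-N) h
    refine prev_eq (by omega) (by rw [hHn]; exact hp.2) fun l hl hl' => ?_
    rw [hHn]
    rcases lt_or_ge l (-N : ℤ) with hlN | hlN
    · exact lt_bitHeight_of_prev_lt hl hlN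
    · rcases le_or_gt l (N + 1 : ℤ) with hlN' | hlN'
      · exact h1 l (habs l hlN hlN')
      · exact hln l hlN'.le hl'.le
  -- In `x'` the same letter closes at height `h + c`, which on the left is the level `h + c - d` of
  -- `x`.
  have hε' : ε (bits x') n = prev (bits x) (-N) (h + (c - d)) := by
    have hp := prev_mem hz (-N) (h + (c - d))
    have e : bitHeight (bits x') (n + 1) = h + c := by rw [hc _ (by omega), hHn]
    refine prev_eq (by omega) (by rw [e, hd _ (by omega)]; omega) fun l hl hl' => ?_
    rw [e]
    rcases lt_or_ge l (-N : ℤ) with hlN | hlN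
    · rw [hd l hlN.le]
      have := lt_bitHeight_of_prev_lt hl hlN
      omega
    · rcases le_or_gt l (N + 1 : ℤ) with hlN' | hlN'
      · exact h2 l (habs l hlN hlN')
      · rw [hc l (by omega)]
        have := hln l hlN'.le hl'.le
        omega
  have hnabs : (N : ℤ) < |n| := lt_of_lt_of_le (by omega) (le_abs_self n)
  have hpabs : (N : ℤ) < |prev (bits x) (-N) (h + (c - d))| :=
    lt_of_lt_of_le (by have := (prev_mem hz (-N) (h + (c - d))).1; omega) (neg_le_abs _)
  have hb : bits x' n = bits x n := by unfold bits; rw [hxx n hnabs]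
  have t1 := typ_ε_of_mem_shiftSpace hx.1 hz hn
  have t2 := typ_ε_of_mem_shiftSpace hx'.1 hz' (hb.trans hn)
  rw [hε] at t1
  rw [hε'] at t2
  have t3 : typ x' n = typ x n := by unfold typ; rw [hxx n hnabs]
  have t4 : typ x' (prev (bits x) (-N) (h + (c - d))) =
      typ x (prev (bits x) (-N) (h + (c - d))) := by
    unfold typ; rw [hxx _ hpabs]
  rw [t1, ← t3, ← t2, t4]

/-- Iterating `typ_prev_eq_of_shift` along levels spaced by `|c - d|` gives infinitely many ones
with equal types. Their places depend on the bits alone, so for fixed bits this is one event about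
the types. -/
theorem exists_constant_types {z z' : ℤ → Fin 2} (hz : Unbounded (bitHeight z)) {N : ℕ} {c d : ℤ}
    (hc : ∀ k : ℤ, N < k → bitHeight z' k = bitHeight z k + c)
    (hd : ∀ k : ℤ, k ≤ -N → bitHeight z' k = bitHeight z k + d) (hcd : c ≠ d) :
    ∃ s : ℕ → ℤ, Function.Injective s ∧ (∀ k, z (s k) = 1) ∧
      ∀ x x' : ℤ → Letter m, x ∈ B m {⊥} {⊥} → x' ∈ B m {⊥} {⊥} → bits x = z → bits x' = z' →
        (∀ k : ℤ, (N : ℤ) < |k| → x k = x' k) → ∀ k, typ x (s k) = typ x (s 0) := by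
  obtain ⟨a₁, ha₁⟩ := exists_lt_on_window (bitHeight z) (N + 1)
  obtain ⟨a₂, ha₂⟩ := exists_lt_on_window (bitHeight z') (N + 1)
  set e := |c - d| with he
  have hepos : 0 < e := abs_pos.2 (sub_ne_zero.2 hcd)
  have hce : c - d = e ∨ c - d = -e := by
    rcases abs_choice (c - d) with h | h <;> omega
  set h₀ := min (a₁ - e) (a₂ - c) with hh₀
  have hle1 : h₀ ≤ a₁ - e := min_le_left _ _
  have hle2 : h₀ ≤ a₂ - c := min_le_right _ _
  have hN : a₁ < bitHeight z (-N) := ha₁ _ (by rw [abs_neg, Nat.abs_cast]; push_cast; omega)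
  have hlow : ∀ k : ℕ, h₀ - k * e ≤ h₀ := fun k => by
    have : 0 ≤ (k : ℤ) * e := by positivity
    omega
  have hlt : ∀ k : ℕ, h₀ - k * e < bitHeight z (-N) := fun k => by
    have := hlow k
    omega
  refine ⟨fun k => prev z (-N) (h₀ - k * e), fun j k hjk => ?_, fun k => prev_eq_one hz (hlt k), ?_⟩
  · have := congrArg (bitHeight z) hjk
    simp only [bitHeight_prev hz (hlt _)] at this
    have h5 : (j : ℤ) * e = k * e := by omega
    exact_mod_cast mul_right_cancel₀ hepos.ne' h5
  · rintro x x' hx hx' rfl rfl hxx k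
    have key : ∀ h, h ≤ h₀ → typ x (prev (bits x) (-N) h) =
        typ x (prev (bits x) (-N) (h + (c - d))) := fun h hh =>
      typ_prev_eq_of_shift hx hx' hxx hc hd
        (fun k hk => by have := ha₁ k hk; omega) (fun k hk => by have := ha₂ k hk; omega)
    induction k with
    | zero => rfl
    | succ k ih =>
      rw [← ih]
      have e1 : h₀ - ((k + 1 : ℕ) : ℤ) * e = h₀ - k * e - e := by push_cast; ring
      simp only [e1]
      -- The sign of `c - d` decides whether the relation is used at the lower or at the upper of
      -- two adjacent levels.
      rcases hce with h | h
      · rw [key _ (by have := hlow k; omega), h, sub_add_cancel]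
      · rw [key (h₀ - k * e) (hlow k), h, ← sub_eq_add_neg]

/-- For each common value `v`, the first `K` constraints have probability `m⁻ᴷ`, which tends to zero
as `m > 1`. -/
theorem μ₂_constant_eq_zero (hm : 1 < m) {s : ℕ → ℤ} (hs : Function.Injective s) :
    μ₂ m {t | ∀ k, t (s k) = t (s 0)} = 0 := by
  have hsub : {t : ℤ → Fin m | ∀ k, t (s k) = t (s 0)} ⊆ ⋃ v : Fin m, {t | ∀ k, t (s k) = v} :=
    fun t ht => Set.mem_iUnion.2 ⟨t (s 0), ht⟩
  refine measure_mono_null hsub (measure_iUnion_null fun v => ?_)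
  have hle : ∀ K : ℕ, μ₂ m {t | ∀ k, t (s k) = v} ≤ ((m : ENNReal)⁻¹) ^ K := by
    intro K
    have h1 : {t : ℤ → Fin m | ∀ k, t (s k) = v} ⊆
        Set.pi (((Finset.range K).image s : Finset ℤ) : Set ℤ) fun _ => {v} := by
      intro t ht i hi
      obtain ⟨k, -, rfl⟩ := Finset.mem_image.1 (Finset.mem_coe.1 hi)
      exact ht k
    refine (measure_mono h1).trans (le_of_eq ?_)
    rw [μ₂, Measure.infinitePi_pi _ fun _ _ => measurableSet_singleton v, Finset.prod_const,
      Finset.card_image_of_injective _ hs, Finset.card_range, uniformOn_univ,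
      Measure.count_singleton, Fintype.card_fin, one_div]
  have hlim : Tendsto (fun K : ℕ => ((m : ENNReal)⁻¹) ^ K) atTop (nhds 0) :=
    ENNReal.tendsto_pow_atTop_nhds_zero_of_lt_one
      (ENNReal.inv_lt_one.2 (by exact_mod_cast hm))
  exact le_antisymm (ge_of_tendsto' hlim hle) bot_le

/-- The point `x` with the letters in `[-N, N]` replaced by `w`. -/
def splice {N : ℕ} (w : ↥(Finset.Ico (-N : ℤ) (N + 1)) → Letter m) (x : ℤ → Letter m) (k : ℤ) :
    Letter m :=
  if h : k ∈ Finset.Ico (-N : ℤ) (N + 1) then w ⟨k, h⟩ else x k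

theorem mem_window_iff (N : ℕ) (k : ℤ) : k ∈ Finset.Ico (-N : ℤ) (N + 1) ↔ ¬ (N : ℤ) < |k| := by
  rw [Finset.mem_Ico, not_lt, abs_le]
  omega

/-- The sum of the signs of the bits in `[-N, N]`. -/
def windowSum (N : ℕ) (z : ℤ → Fin 2) : ℤ := ∑ i ∈ Finset.Ico (-N : ℤ) (N + 1), sgn (z i)

/-- The points of `B` that stay in `B` when `w` is spliced in, with a shift of the heights. -/
def shiftedBy {N : ℕ} (w : ↥(Finset.Ico (-N : ℤ) (N + 1)) → Letter m) : Set (ℤ → Letter m) :=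
  {x | x ∈ B m {⊥} {⊥} ∧ splice w x ∈ B m {⊥} {⊥} ∧
    windowSum N (bits (splice w x)) ≠ windowSum N (bits x)}

theorem measurableSet_shiftedBy {N : ℕ} (w : ↥(Finset.Ico (-N : ℤ) (N + 1)) → Letter m) :
    MeasurableSet (shiftedBy w) := by
  have hs : Measurable (splice w) := measurable_pi_lambda _ fun k => by
    unfold splice
    split_ifs
    · exact measurable_const
    · exact measurable_pi_apply k
  have hw : Measurable fun x : ℤ → Letter m => windowSum N (bits x) :=
    Finset.measurable_fun_sum _ fun i _ =>
      (measurable_of_countable sgn).comp ((measurable_pi_apply i).comp measurable_bits)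
  exact measurableSet_B.inter ((hs measurableSet_B).inter
    (measurableSet_eq_fun (hw.comp hs) hw).compl)

theorem codeMeasure_shiftedBy (hm : 1 < m) {N : ℕ}
    (w : ↥(Finset.Ico (-N : ℤ) (N + 1)) → Letter m) : codeMeasure m μ₁ (shiftedBy w) = 0 := by
  have hD := measurableSet_shiftedBy w
  rw [codeMeasure_apply _ hD]
  refine (lintegral_congr_ae ?_).trans lintegral_zero
  filter_upwards [ae_unbounded_μ₁] with z hz
  have hc : Measurable fun t : ℤ → Fin m => code z t := measurable_code measurable_const measurable_id
  have h1 : ∫⁻ t, (shiftedBy w).indicator 1 (code z t) ∂(μ₂ m) =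
      μ₂ m {t | code z t ∈ shiftedBy w} := by
    rw [← lintegral_map (measurable_one.indicator hD) hc, lintegral_indicator_one hD,
      Measure.map_apply hc hD]
    rfl
  change _ = (0 : ENNReal)
  rw [h1]
  rcases Set.eq_empty_or_nonempty {t : ℤ → Fin m | code z t ∈ shiftedBy w} with h0 | ⟨t₀, ht₀⟩
  · rw [h0, measure_empty]
  set z' := bits (splice w (code z t₀)) with hz'
  -- The bits after splicing come from `w` inside the window and from `z` outside, so one sequence
  -- of places serves all `t`.
  have hbits : ∀ t : ℤ → Fin m, bits (splice w (code z t)) = z' := by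
    intro t
    ext1 k
    rw [hz']
    have hb : ∀ t : ℤ → Fin m, bits (splice w (code z t)) k =
        if h : k ∈ Finset.Ico (-N : ℤ) (N + 1) then
          Sum.elim (fun _ => 1) (fun _ => 0) (w ⟨k, h⟩) else z k := by
      intro t
      by_cases h : k ∈ Finset.Ico (-N : ℤ) (N + 1)
      · rw [dif_pos h, bits, splice, dif_pos h]
      · rw [dif_neg h, bits, splice, dif_neg h]
        exact congrFun (bits_code z t) k
    rw [hb, hb]
  have hsp : ∀ x : ℤ → Letter m, ∀ k : ℤ, (N : ℤ) < |k| → x k = splice w x k := fun x k hk => by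
    rw [splice, dif_neg (mt (mem_window_iff N k).1 (not_not.2 hk))]
  have hag : ∀ k : ℤ, (N : ℤ) < |k| → z k = z' k := fun k hk => by
    conv_lhs => rw [← bits_code z t₀]
    rw [hz', bits, bits, ← hsp _ k hk]
  obtain ⟨c, d, hc', hd', hcd⟩ := exists_bitHeight_shift hag
  have hne : c ≠ d := by
    have h5 := ht₀.2.2
    rw [← hz', bits_code] at h5
    unfold windowSum at h5
    omega
  obtain ⟨s, hs, hs1, hconst⟩ := exists_constant_types (m := m) hz hc' hd' hne
  refine measure_mono_null ?_ (μ₂_constant_eq_zero hm hs)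
  intro t ht k
  have := hconst (code z t) _ ht.1 ht.2.1 (bits_code z t) (hbits t) (hsp _) k
  rwa [typ_code_of_one t (hs1 k), typ_code_of_one t (hs1 0)] at this

/-- The points of `B` that agree with another point of `B` off a window that shifts the heights. -/
def shifted (m : ℕ) : Set (ℤ → Letter m) :=
  {x | x ∈ B m {⊥} {⊥} ∧ ∃ x' ∈ B m {⊥} {⊥}, ∃ N : ℕ, (∀ k : ℤ, (N : ℤ) < |k| → x k = x' k) ∧
    windowSum N (bits x') ≠ windowSum N (bits x)}

theorem codeMeasure_shifted (hm : 1 < m) : codeMeasure m μ₁ (shifted m) = 0 := by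
  refine measure_mono_null ?_ (measure_iUnion_null fun N : ℕ =>
    measure_iUnion_null fun w => codeMeasure_shiftedBy hm (N := N) w)
  rintro x ⟨hx, x', hx', N, hN, hne⟩
  refine Set.mem_iUnion.2 ⟨N, Set.mem_iUnion.2 ⟨fun k => x' k, ?_⟩⟩
  have e : splice (N := N) (fun k => x' k) x = x' := by
    ext1 k
    unfold splice
    split_ifs with h
    · rfl
    · exact hN k (not_not.1 (mt (mem_window_iff N k).2 h))
  refine ⟨hx, ?_, ?_⟩ <;> rwa [e]

/-! ## Invariance -/

/-- Finitary changes of coordinates, as a countable type. -/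
abbrev Change (m : ℕ) : Type :=
  Σ N : ℕ, Equiv.Perm ↥(Finset.Ico (-N : ℤ) (N + 1)) × (↥(Finset.Ico (-N : ℤ) (N + 1)) → Fin m)

/-- The map given by a finitary change of coordinates. -/
def Change.map (i : Change m) : (ℤ → Letter m) → ℤ → Letter m :=
  act (Equiv.Perm.ofSubtype i.2.1)
    fun k => if h : k ∈ Finset.Ico (-i.1 : ℤ) (i.1 + 1) then i.2.2 ⟨k, h⟩ else 0

theorem fixesOff_ofSubtype {N : ℕ} (σ : Equiv.Perm ↥(Finset.Ico (-N : ℤ) (N + 1))) :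
    FixesOff N (Equiv.Perm.ofSubtype σ) := fun k hk =>
  Equiv.Perm.ofSubtype_apply_of_not_mem σ (mt (mem_window_iff N k).1 (not_not.2 hk))

/-- Equal sums mean equally many ones, and a bijection between the ones extends to a permutation of
the window. -/
theorem exists_perm_of_windowSum_eq {N : ℕ} {z z' : ℤ → Fin 2}
    (h : windowSum N z' = windowSum N z) :
    ∃ σ : Equiv.Perm ↥(Finset.Ico (-N : ℤ) (N + 1)), ∀ k, z (σ k) = z' k := by
  have hcard : ∀ y : ℤ → Fin 2, windowSum N y =
      2 * (Fintype.card {k : ↥(Finset.Ico (-N : ℤ) (N + 1)) // y k = 1} : ℤ) -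
        (Finset.Ico (-N : ℤ) (N + 1)).card := by
    intro y
    have e : ∀ b : Fin 2, sgn b = 2 * (if b = 1 then 1 else 0) - 1 := by
      intro b
      rcases fin_two_cases b with rfl | rfl <;> simp [sgn]
    rw [windowSum, ← Finset.sum_coe_sort]
    simp only [e, Finset.sum_sub_distrib, ← Finset.mul_sum, Finset.sum_boole]
    rw [Fintype.card_subtype]
    simp
  have hc : Fintype.card {k : ↥(Finset.Ico (-N : ℤ) (N + 1)) // z' k = 1} =
      Fintype.card {k : ↥(Finset.Ico (-N : ℤ) (N + 1)) // z k = 1} := by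
    have h1 := hcard z
    have h2 := hcard z'
    omega
  let e := Fintype.equivOfCardEq hc
  refine ⟨e.extendSubtype, fun k => ?_⟩
  rcases fin_two_cases (z' k) with hk | hk
  · have := e.extendSubtype_not_mem k (by rw [hk]; decide)
    rw [hk]
    exact (fin_two_cases _).resolve_right this
  · rw [hk]
    exact e.extendSubtype_mem k hk

theorem exists_change {x x' : ℤ → Letter m} (hx' : x' ∈ B m {⊥} {⊥}) {N : ℕ}
    (hN : ∀ k : ℤ, (N : ℤ) < |k| → x k = x' k)
    (hs : windowSum N (bits x') = windowSum N (bits x)) : ∃ i : Change m, i.map x = x' := by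
  obtain ⟨σ, hσ⟩ := exists_perm_of_windowSum_eq hs
  refine ⟨⟨N, σ, fun k => typ x' k - typ x (σ k)⟩, ?_⟩
  rw [Change.map, act]
  conv_rhs => rw [← code_eq_of_mem_B hx']
  have h : ∀ k : ℤ, (N : ℤ) < |k| ∨ k ∈ Finset.Ico (-N : ℤ) (N + 1) := fun k => by
    rw [mem_window_iff]
    exact em _
  congr 1
  · ext1 k
    rcases h k with hk | hk
    · rw [Function.comp_apply, fixesOff_ofSubtype σ k hk, bits, bits, hN k hk]
    · rw [Function.comp_apply, Equiv.Perm.ofSubtype_apply_of_mem σ hk]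
      exact hσ ⟨k, hk⟩
  · ext1 k
    rcases h k with hk | hk
    · simp only
      rw [dif_neg (mt (mem_window_iff N k).1 (not_not.2 hk)), add_zero,
        fixesOff_ofSubtype σ k hk, typ, typ, hN k hk]
    · simp only
      rw [dif_pos hk, Equiv.Perm.ofSubtype_apply_of_mem σ hk, add_sub_cancel]

/-- By `act_code`, in the coordinates of bits and types this is a product of two measure-preserving
maps. -/
theorem measurePreserving_act_codeMeasure {N : ℕ} {σ : Equiv.Perm ℤ} (hσ : FixesOff N σ)
    (a : ℤ → Fin m) : MeasurePreserving (act σ a) (codeMeasure m μ₁) (codeMeasure m μ₁) := by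
  have h1 : MeasurePreserving (fun z : ℤ → Fin 2 => z ∘ σ) μ₁ μ₁ :=
    measurePreserving_comp_perm σ
  have h2 : MeasurePreserving (fun t : ℤ → Fin m => t ∘ σ + a) (μ₂ m) (μ₂ m) :=
    (measurePreserving_add a).comp (measurePreserving_comp_perm σ)
  have h := h1.prod h2
  refine ⟨measurable_act σ a, ?_⟩
  conv_rhs => rw [codeMeasure, ← h.map_eq]
  rw [codeMeasure, Measure.map_map (measurable_act σ a) measurable_code_prod,
    Measure.map_map measurable_code_prod h.measurable]
  refine Measure.map_congr ?_
  have := (Measure.quasiMeasurePreserving_fst (μ := μ₁) (ν := μ₂ m)).ae ae_unbounded_μ₁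
  filter_upwards [this] with p hp using act_code hσ a hp p.2

theorem ae_mem_B_codeMeasure : ∀ᵐ x ∂(codeMeasure m μ₁), x ∈ B m {⊥} {⊥} := by
  refine (ae_map_iff (p := fun x => x ∈ B m {⊥} {⊥}) measurable_code_prod.aemeasurable
    measurableSet_B).2 ?_
  have := (Measure.quasiMeasurePreserving_fst (μ := μ₁) (ν := μ₂ m)).ae ae_unbounded_μ₁
  filter_upwards [this] with p hp using code_mem_B hp p.2

theorem codeMeasure_image_change (i : Change m) {A : Set (ℤ → Letter m)} (hA : MeasurableSet A)
    (hAB : A ⊆ B m {⊥} {⊥}) : codeMeasure m μ₁ (i.map '' A) = codeMeasure m μ₁ A := by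
  have hp := measurePreserving_act_codeMeasure (m := m) (fixesOff_ofSubtype i.2.1)
    fun k => if h : k ∈ Finset.Ico (-i.1 : ℤ) (i.1 + 1) then i.2.2 ⟨k, h⟩ else 0
  change MeasurePreserving i.map _ _ at hp
  have hinj : Set.InjOn i.map (B m {⊥} {⊥}) := injOn_act _ _
  have hm : MeasurableSet (i.map '' A) := hA.image_of_measurable_injOn hp.measurable (hinj.mono hAB)
  rw [← hp.measure_preimage hm.nullMeasurableSet]
  refine measure_congr ?_
  filter_upwards [ae_mem_B_codeMeasure] with x hx
  refine propext ⟨?_, fun h => ⟨x, h, rfl⟩⟩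
  rintro ⟨y, hy, hyx⟩
  rwa [← hinj (hAB hy) hx hyx]

/-- A holonomy that is given piecewise by finitary changes of coordinates preserves the measure. -/
theorem codeMeasure_eq_of_cover {A : Set (ℤ → Letter m)} {g : (ℤ → Letter m) → ℤ → Letter m}
    (hA : MeasurableSet A) (hAB : A ⊆ B m {⊥} {⊥}) (hg : Measurable fun x : A => g x)
    (hinj : Set.InjOn g A) (hcov : ∀ x ∈ A, ∃ i : Change m, i.map x = g x) :
    codeMeasure m μ₁ A = codeMeasure m μ₁ (g '' A) := by
  have : StandardBorelSpace A := hA.standardBorel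
  have e1 : MeasurableEmbedding (Subtype.val : A → ℤ → Letter m) := MeasurableEmbedding.subtype_coe hA
  have e2 : MeasurableEmbedding fun x : A => g x := hg.measurableEmbedding hinj.injective
  -- The measure is pulled back to `A` along the inclusion and along `g`. The pullbacks agree on
  -- each piece where `g` is a fixed change, and overlaps of pieces are harmless.
  have key : (codeMeasure m μ₁).comap (Subtype.val : A → ℤ → Letter m) =
      (codeMeasure m μ₁).comap fun x : A => g x := by
    have hV : ∀ i : Change m, MeasurableSet {x : A | i.map x = g x} := fun i =>
      measurableSet_eq_fun ((measurable_act _ _).comp measurable_subtype_coe) hg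
    refine (Measure.ext_iff_of_iUnion_eq_univ (s := fun i : Change m => {x : A | i.map x = g x})
      ?_).2 fun i => ?_
    · exact Set.eq_univ_of_forall fun x => Set.mem_iUnion.2 (hcov x x.2)
    · ext U hU
      rw [Measure.restrict_apply hU, Measure.restrict_apply hU, e1.comap_apply, e2.comap_apply,
        ← codeMeasure_image_change i (e1.measurableSet_image.2 (hU.inter (hV i)))
          (by rintro _ ⟨x, -, rfl⟩; exact hAB x.2), Set.image_image]
      congr 1
      exact Set.image_congr fun x hx => hx.2
  have h := congrArg (fun κ => κ Set.univ) key
  simp only [e1.comap_apply, e2.comap_apply, Set.image_univ, Subtype.range_coe] at h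
  rw [h, Set.image_eq_range]

theorem measure_union_of_null {Ω : Type*} [MeasurableSpace Ω] {μ : Measure Ω} {s t : Set Ω}
    (ht : μ t = 0) : μ (s ∪ t) = μ s :=
  le_antisymm ((measure_union_le s t).trans (by rw [ht, add_zero]))
    (measure_mono Set.subset_union_left)

theorem isDoubleTailInvariant_codeMeasure (hm : 1 < m) :
    IsDoubleTailInvariant (shiftSpace m) (codeMeasure m μ₁) := by
  intro A g hg
  have hAm := hg.measurableSet
  -- On `G` the map is piecewise a finitary change. The rest of `A` and its image lie outside `B m
  -- {⊥} {⊥}` or in `shifted m`, both null.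
  set G : Set (ℤ → Letter m) :=
    Subtype.val '' {x : A | (x : ℤ → Letter m) ∈ B m {⊥} {⊥} ∧ ∃ i : Change m, i.map x = g x}
    with hG
  have hGA : G ⊆ A := by
    rintro _ ⟨x, -, rfl⟩
    exact x.2
  have hGspec : ∀ x ∈ G, x ∈ B m {⊥} {⊥} ∧ ∃ i : Change m, i.map x = g x := by
    rintro _ ⟨x, hx, rfl⟩
    exact hx
  have hGm : MeasurableSet G := by
    refine hAm.subtype_image (MeasurableSet.inter (measurable_subtype_coe measurableSet_B)
      (?_ : MeasurableSet {x : A | ∃ i : Change m, i.map x = g x}))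
    have : {x : A | ∃ i : Change m, i.map x = g x} = ⋃ i : Change m, {x : A | i.map x = g x} := by
      ext x
      simp
    rw [this]
    exact MeasurableSet.iUnion fun i =>
      measurableSet_eq_fun ((measurable_act _ _).comp measurable_subtype_coe) hg.measurable
  have hnull : codeMeasure m μ₁ ((B m {⊥} {⊥})ᶜ ∪ shifted m) = 0 :=
    measure_union_null ae_mem_B_codeMeasure (codeMeasure_shifted hm)
  have hrest : ∀ x ∈ A \ G, x ∈ (B m {⊥} {⊥})ᶜ ∪ shifted m ∧ g x ∈ (B m {⊥} {⊥})ᶜ ∪ shifted m := by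
    rintro x ⟨hxA, hxG⟩
    have ht := hg.mem_doubleTail x hxA
    by_cases hxB : x ∈ B m {⊥} {⊥}
    · have hgB := mem_B_of_doubleTail ht hxB
      obtain ⟨N, hN⟩ := ht.2.2
      have hne : windowSum N (bits (g x)) ≠ windowSum N (bits x) := fun heq =>
        hxG ⟨⟨x, hxA⟩, ⟨hxB, exists_change hgB hN heq⟩, rfl⟩
      exact ⟨Or.inr ⟨hxB, g x, hgB, N, hN, hne⟩,
        Or.inr ⟨hgB, x, hxB, N, fun k hk => (hN k hk).symm, hne.symm⟩⟩
    · exact ⟨Or.inl hxB, Or.inl fun h => hxB (mem_B_of_doubleTail (doubleTail_symm ht) h)⟩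
  have hun : A = G ∪ A \ G := (Set.union_sdiff_cancel hGA).symm
  have h1 : codeMeasure m μ₁ A = codeMeasure m μ₁ G := by
    rw [hun]
    exact measure_union_of_null (measure_mono_null (fun x hx => (hrest x hx).1) hnull)
  have h2 : codeMeasure m μ₁ (g '' A) = codeMeasure m μ₁ (g '' G) := by
    rw [hun, Set.image_union]
    refine measure_union_of_null (measure_mono_null ?_ hnull)
    rintro _ ⟨x, hx, rfl⟩
    exact (hrest x hx).2
  rw [h1, h2]
  exact codeMeasure_eq_of_cover hGm (fun x hx => (hGspec x hx).1)
    (hg.measurable.comp (measurable_inclusion hGA)) (hg.injOn.mono hGA)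
    fun x hx => (hGspec x hx).2

end

end DyckShift

end

theorem mainTheorem3 (m : ℕ) (hm : 1 < m) :
    (IsProbabilityMeasure (DyckShift.μTilde m) ∧
      DyckShift.IsDoubleTailInvariant (DyckShift.shiftSpace m) (DyckShift.μTilde m) ∧
      DyckShift.μTilde m (DyckShift.B m {⊥} {⊥}) = 1) ∧
    ∀ ν : Measure (ℤ → DyckShift.Letter m), IsProbabilityMeasure ν →
      DyckShift.IsDoubleTailInvariant (DyckShift.shiftSpace m) ν →
      ν (DyckShift.B m {⊥} {⊥}) = 1 →
      ν = DyckShift.μTilde m := by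
  have : NeZero m := ⟨by omega⟩
  rw [DyckShift.μTilde_eq_codeMeasure]
  refine ⟨⟨inferInstance, DyckShift.isDoubleTailInvariant_codeMeasure hm, ?_⟩, ?_⟩
  · exact prob_compl_eq_zero_iff DyckShift.measurableSet_B |>.1 DyckShift.ae_mem_B_codeMeasure
  · intro ν hν hinv hB
    have hB' : ∀ᵐ x ∂ν, x ∈ DyckShift.B m {⊥} {⊥} :=
      (prob_compl_eq_zero_iff DyckShift.measurableSet_B).2 hB
    rw [← DyckShift.map_bits_eq hinv hB']
    exact DyckShift.eq_codeMeasure hinv hB'
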